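/- **Setting.** Fix $d$ and a Lipschitz constant $G>0$. In each round $t=1,2,\dots$ the learner predicts $x_t\in\mathbb R^d$; an adaptive environment $\mathcal E$, knowing $x_1,\dots,x_t$, reveals a convex loss $l_t:\mathbb R^d\to\mathbb R$ that is $G$-Lipschitz for $\|\cdot\|_2$, and the learner observes some subgradient $g_t\in\partial l_t(x_t)$. For a comparator sequence $u_{1:T}\in\mathbb R^{dT}$ the unconstrained dynamic regret is $$\mathrm{Reg}_T(u_{1:T})=\sup_{\mathcal E}\Big[\sum_{t=1}^T l_t(x_t)-\sum_{t=1}^T l_t(u_t)\Big].$$ **Algorithm (anytime Haar OLR).** FreeGrad with hyperparameter $\varepsilon>0$, after receiving gradients $\hat g_1,\dots,\hat g_n\in\mathbb R^d$, outputs, with $s=\sum_i\hat g_i$ and $v=G^2+\sum_i\|\hat g_i\|_2^2$, $$\hat x=-\varepsilon s\cdot\frac{(2v+G\|s\|_2)G^2}{2(v+G\|s\|_2)^2\sqrt v}\exp\Big(\frac{\|s\|_2^2}{2v+2G\|s\|_2}\Big).$$ For $m\ge1$ the Haar dictionary of length $2^m$ consists of the all-one feature and, for $j\in\{1,\dots,m\}$,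 $l\in\{1,\dots,2^{m-j}\}$, the feature $h^{(j,l)}$ with entries $1$ for $2^j(l-1)<t\le 2^j(l-1)+2^{j-1}$, $-1$ for $2^j(l-1)+2^{j-1}<t\le 2^jl$, and $0$ otherwise. Haar OLR with horizon $2^m$ and hyperparameter $\varepsilon$ runs, for each of the $2^m$ features $h$, its own copy of FreeGrad with hyperparameter $\varepsilon/2^m$; the copy is used only in rounds with $h_t\ne0$, where its output $\hat x_{t,h}$ contributes $h_t\hat x_{t,h}$ to the prediction $x_t=\sum_h h_t\hat x_{t,h}$ and it is fed the gradient $h_tg_t$. Anytime Haar OLR runs, for $m=1,2,\dots$ in turn, a fresh copy of Haar OLR with horizon $2^m$ and $\varepsilon=1$ for $2^m$ rounds. **Theorem 3 (Path length bound).** Let $\bar u=\frac1T\sum_{t=1}^Tu_t$, $P=\sum_{t=1}^{T-1}\|u_{t+1}-u_t\|_2$, $\bar S=\sum_{t=1}^T\|u_t-\bar u\|_2$ and $M=\max_t\|u_t\|_2$. There are absolute constants $C>0$ and $k\in\mathbb N$ such that for all $d$, all $G>0$, all $T\ge1$ and all $u_{1:T}\in\mathbb R^{dT}$, anytime Haar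 OLR guarantees $$\mathrm{Reg}_T(u_{1:T})\le C\,G\log(T+1)+C\,G\Big(\|\bar u\|_2\sqrt T+\sqrt{P\bar S}\Big)\big(\log(2+M+T)\big)^k,$$ that is, $\mathrm{Reg}_T(u_{1:T})\le\tilde O\big(\|\bar u\|_2\sqrt T+\sqrt{P\bar S}\big)$. -/

import Mathlib

/-!
Unconstrained dynamic online convex optimization, the FreeGrad static learner, and the anytime
Haar online-linear-regression algorithm.
-/

noncomputable section

namespace HaarOLR

/-- The decision space `ℝ^d` with the Euclidean norm. -/
abbrev Vec (d : ℕ) : Type := EuclideanSpace ℝ (Fin d)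

/-! ### The game -/

/-- A deterministic learner with first-order feedback: its prediction in a round is a function of
the list of loss (sub)gradients `g_1, …, g_{t-1}` of the previous rounds, in chronological order. -/
abbrev Learner (d : ℕ) : Type := List (Vec d) → Vec d

/-- An adaptive adversarial environment with `G`-Lipschitz convex losses.  In every round it sees
the list `past` of the previous predictions `x_1, …, x_{t-1}` and the current prediction `x = x_t`;
it reveals a convex `G`-Lipschitz loss `l_t`, of which the learner observes one subgradient
at `x_t`, chosen arbitrarily by the environment. -/
structure Environment (d : ℕ) (G : ℝ) where
  /-- the loss function `l_t` -/
  loss : (past : List (Vec d)) → (x : Vec d) → Vec d → ℝ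
  /-- the observed subgradient `g_t ∈ ∂ l_t(x_t)` -/
  grad : (past : List (Vec d)) → (x : Vec d) → Vec d
  convex : ∀ past x, ConvexOn ℝ Set.univ (loss past x)
  lipschitz : ∀ past x, LipschitzWith (Real.toNNReal G) (loss past x)
  subgradient : ∀ past x y,
    loss past x x + inner ℝ (grad past x) (y - x) ≤ loss past x y

variable {d : ℕ} {G : ℝ}

/-- The predictions and the observed subgradients of the first `t` rounds. -/
def play (A : Learner d) (env : Environment d G) : ℕ → List (Vec d) × List (Vec d)
  | 0 => ([], [])
  | t + 1 =>
    let h := play A env t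
    let x := A h.2
    (h.1 ++ [x], h.2 ++ [env.grad h.1 x])

/-- The prediction made after `t` completed rounds, i.e. `x_{t+1}`. -/
def prediction (A : Learner d) (env : Environment d G) (t : ℕ) : Vec d :=
  A (play A env t).2

/-- The loss function revealed after `t` completed rounds, i.e. `l_{t+1}`. -/
def lossAt (A : Learner d) (env : Environment d G) (t : ℕ) : Vec d → ℝ :=
  env.loss (play A env t).1 (prediction A env t)

/-- The unconstrained dynamic regret
`sup_env (∑_{t=1}^T l_t(x_t) - ∑_{t=1}^T l_t(u_t))`, as an extended real number. -/
def regret (A : Learner d) (G : ℝ) {T : ℕ} (u : Fin T → Vec d) : EReal :=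
  ⨆ env : Environment d G,
    (((∑ t : Fin T, lossAt A env t (prediction A env t)
      - ∑ t : Fin T, lossAt A env t (u t) : ℝ)) : EReal)

/-! ### Statistics of the comparator sequence -/

/-- The comparator average `ū`. -/
def average {T : ℕ} (u : Fin T → Vec d) : Vec d := (T : ℝ)⁻¹ • ∑ t, u t

/-- The path length `P = ∑_{t=1}^{T-1} ‖u_{t+1} - u_t‖`. -/
def pathLength {T : ℕ} (u : Fin T → Vec d) : ℝ :=
  ∑ t : Fin (T - 1), ‖u ⟨(t : ℕ) + 1, by omega⟩ - u ⟨(t : ℕ), by omega⟩‖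

/-- The first order variability `S̄ = ∑_{t=1}^T ‖u_t - ū‖`. -/
def variability {T : ℕ} (u : Fin T → Vec d) : ℝ :=
  (∑ t : Fin T, ‖u t - average u‖)

/-- The maximum range `M = max_t ‖u_t‖`. -/
def maxRange {T : ℕ} (u : Fin T → Vec d) : ℝ :=
  (⨆ t : Fin T, ‖u t‖)

/-! ### FreeGrad -/

/-- The `d`-dimensional FreeGrad learner with hyperparameter `ε` and Lipschitz constant `G`:
with `s` the sum of the observed gradients and `v = G² +` the sum of their squared norms. -/
def freeGrad (ε G : ℝ) : Learner d := fun gs =>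
  let s : Vec d := gs.sum
  let v : ℝ := G ^ 2 + (gs.map fun g => ‖g‖ ^ 2).sum
  let c : ℝ := -ε * ((2 * v + G * ‖s‖) * G ^ 2 / (2 * (v + G * ‖s‖) ^ 2 * √v))
    * Real.exp (‖s‖ ^ 2 / (2 * v + 2 * G * ‖s‖))
  c • s

/-! ### The Haar dictionary -/

/-- The `t`-th entry (`t ≥ 1`) of the Haar feature with scale `j ≥ 1` and location `l ≥ 1`. -/
def haarFeature (j l t : ℕ) : ℝ :=
  if t ∈ Finset.Icc (2 ^ j * (l - 1) + 1) (2 ^ j * (l - 1) + 2 ^ (j - 1)) then 1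
  else if t ∈ Finset.Icc (2 ^ j * (l - 1) + 2 ^ (j - 1) + 1) (2 ^ j * l) then -1
  else 0

/-- The all-one feature. -/
def oneFeature (_t : ℕ) : ℝ := 1

/-! ### The Haar OLR algorithm -/

/-- The surrogate gradients `h_i g_i` that are sent to the static learner attached to the feature
`h`: only the rounds `i` with `h_i ≠ 0` (rounds numbered from `1`) are kept. -/
def surrogateGrads (h : ℕ → ℝ) (gs : List (Vec d)) : List (Vec d) :=
  (gs.zipIdx 1).filterMap fun p => if h p.2 ≠ 0 then some (h p.2 • p.1) else none

/-- The contribution `w_t = h_t x̂_t` of one feature `h`, where `x̂_t` is the output of the copy of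
FreeGrad attached to `h` (if `h_t = 0` the contribution is `0` whatever `x̂_t` is). -/
def featureLearner (ε G : ℝ) (h : ℕ → ℝ) : Learner d := fun gs =>
  h (gs.length + 1) • freeGrad ε G (surrogateGrads h gs)

/-- Haar OLR with known horizon `2 ^ m`: one copy of FreeGrad with hyperparameter `ε / 2 ^ m` for
each of the `2 ^ m` features, the outputs being summed. -/
def haarFixed (m : ℕ) (ε G : ℝ) : Learner d := fun gs =>
  featureLearner (ε / 2 ^ m) G oneFeature gs
    + ∑ j ∈ Finset.Icc 1 m, ∑ l ∈ Finset.Icc 1 (2 ^ (m - j)),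
        featureLearner (ε / 2 ^ m) G (haarFeature j l) gs

/-- Anytime Haar OLR (doubling trick): for `m = 1, 2, …` a fresh copy of `haarFixed m 1 G` is run
for `2 ^ m` rounds.  The `m`-th block consists of the rounds `t` with
`2 ^ m - 1 ≤ t ≤ 2 ^ (m + 1) - 2`, so in round `t = gs.length + 1` the block is
`m = ⌊log₂ (t + 1)⌋`, and the `2 ^ m - 2` gradients of the earlier blocks are discarded. -/
def anytimeHaar (G : ℝ) : Learner d := fun gs =>
  let m := Nat.log 2 (gs.length + 2)
  haarFixed m 1 G (gs.drop (2 ^ m - 2))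

end HaarOLR

end

noncomputable section

namespace HaarOLR

/-! ### A scalar inequality behind the FreeGrad potential -/

/-! Convexity replaces each loss by its linearization at the prediction, so it suffices to bound the
linear regret against arbitrary vectors `g i` of norm at most `G`.

FreeGrad plays minus `ε` times the gradient in `s` of a potential of the form `G² exp(‖s‖²/(2v +
2G‖s‖)) / √v`. One round raises this potential by at most its linearization in `s`
(`potential_step`, resting on the scalar inequality `exponent_step`). Summing telescopes, and a
conjugate bound (`mul_sub_potential_le`) gives static regret `ε G + Õ(‖u‖ G √K)` for a copy active
in at most `K` rounds.

The comparator is expanded in the Haar dictionary (`haar_reconstruction`), and the copy at each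
feature competes with the corresponding coefficient. A coefficient is bounded both by half the path
length on its dyadic interval and by the mean deviation from a centre there. The geometric mean of
the two bounds cancels the square root of the support, and Cauchy–Schwarz over the intervals of one
scale gives `√(P S)` (`sum_norm_haarCoeff_le`). Scales and doubling blocks are logarithmic in number
and cost only logarithms. The all-one feature contributes `‖ū‖ √T`. -/

theorem neg_log_one_sub_le {y : ℝ} (hy : 0 ≤ y) (hy1 : y < 1) :
    -Real.log (1 - y) ≤ y + y ^ 2 / (2 * (1 - y)) := by
  have h1 : 0 < 1 - y := by linarith
  have h0 : 0 ≤ -Real.log (1 - y) := by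
    have := Real.log_nonpos h1.le (by linarith)
    linarith
  -- The bound is `x ≤ sinh x` at `x = -log (1 - y)`.
  have h := Real.self_le_sinh_iff.2 h0
  rw [Real.sinh_eq, neg_neg, Real.exp_neg, Real.exp_log h1] at h
  refine h.trans (le_of_eq ?_)
  field_simp
  ring

theorem neg_log_one_sub_mul_le {b q : ℝ} (hb : 0 ≤ b) (hb1 : b ≤ 1) (hq : 0 ≤ q) (hq1 : q ≤ 1) :
    -Real.log (1 - b * (q - q ^ 2 / 2)) ≤ b * (q - q ^ 2 / 2) + b ^ 2 * q ^ 2 / 2 := by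
  set z : ℝ := q - q ^ 2 / 2 with hz
  have hz0 : 0 ≤ z := by nlinarith
  have hz1 : z ≤ 1 / 2 := by nlinarith [sq_nonneg (q - 1)]
  have hbz : b * z ≤ z := by nlinarith
  refine (neg_log_one_sub_le (mul_nonneg hb hz0) (by linarith)).trans ?_
  have h1 : 0 < 2 * (1 - b * z) := by linarith
  have h2 : z ^ 2 ≤ q ^ 2 * (1 - z) := by
    have : q ^ 2 * (1 - z) - z ^ 2 = q ^ 4 / 4 := by rw [hz]; ring
    have : 0 ≤ q ^ 4 / 4 := by positivity
    linarith
  have h3 : (b * z) ^ 2 / (2 * (1 - b * z)) ≤ b ^ 2 * q ^ 2 / 2 := by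
    rw [div_le_iff₀ h1]
    have h4 : q ^ 2 * (1 - z) ≤ q ^ 2 * (1 - b * z) := by gcongr
    nlinarith [mul_le_mul_of_nonneg_left (h2.trans h4) (sq_nonneg b)]
  linarith

/-- The exponent of the potential after a step is at most its linearization plus the gain of the
normalizing factor, for a step with a nonnegative component along the state. -/
theorem exponent_step_of_nonneg {r v a c ρ : ℝ} (hr : 0 ≤ r) (hv : 1 ≤ v) (ha : 0 ≤ a) (ha1 : a ≤ 1)
    (hc : 0 ≤ c) (hca : c ≤ a) (hρ0 : 0 ≤ ρ) (hρ : ρ ^ 2 = r ^ 2 + 2 * r * c + a ^ 2) :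
    ρ ^ 2 / (2 * (v + a ^ 2 + ρ)) - r ^ 2 / (2 * (v + r))
      ≤ a ^ 2 / (2 * v + a ^ 2)
        + Real.log (1 + c * (r / (v + r) - (r / (v + r)) ^ 2 / 2)) := by
  obtain ⟨w, hw⟩ : ∃ w, w = v + r := ⟨_, rfl⟩
  obtain ⟨q, hq⟩ : ∃ q, q = r / w := ⟨_, rfl⟩
  have hw0 : 0 < w := by linarith
  have hrq : r = q * w := by rw [hq]; field_simp
  have hq0 : 0 ≤ q := by rw [hq]; positivity
  have hq1 : q ≤ 1 := by rw [hq, div_le_one hw0]; linarith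
  rw [← hw, ← hq]
  obtain ⟨y, hy⟩ : ∃ y, y = c * (q - q ^ 2 / 2) := ⟨_, rfl⟩
  rw [← hy]
  have hz0 : 0 ≤ q - q ^ 2 / 2 := by nlinarith
  have hy0 : 0 ≤ y := by rw [hy]; positivity
  have hya : y ≤ a * q := by
    rw [hy]; exact mul_le_mul hca (by nlinarith) hz0 ha
  have hy1 : y ≤ 1 := hya.trans (by nlinarith)
  have hlog := Real.le_log_one_add_of_nonneg hy0
  have hρr : r + c ≤ ρ := by
    refine (le_abs_self _).trans (abs_le_of_sq_le_sq ?_ hρ0)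
    nlinarith
  have h1 : ρ ^ 2 / (2 * (v + a ^ 2 + ρ)) ≤ (r ^ 2 + 2 * r * c + a ^ 2) / (2 * (w + a ^ 2 + c)) := by
    have : 0 < w + a ^ 2 + c := by positivity
    rw [← hρ]
    apply div_le_div_of_nonneg_left (by positivity) (by positivity)
    linarith
  have h2 : a ^ 2 / (2 * (w + a ^ 2 + c)) ≤ a ^ 2 / (2 * v + a ^ 2) := by
    apply div_le_div_of_nonneg_left (by positivity) (by positivity)
    nlinarith
  have h3 : y ^ 2 / 2 ≤ (a ^ 2 * q ^ 2 * w + 2 * y * (a ^ 2 + c)) / (2 * (w + a ^ 2 + c)) := by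
    rw [le_div_iff₀ (by positivity)]
    have e1 : y ^ 2 * w ≤ (a * q) ^ 2 * w := by gcongr
    have e2 : y ^ 2 * (a ^ 2 + c) ≤ 2 * y * (a ^ 2 + c) := by
      gcongr
      nlinarith
    nlinarith
  have h4 : y - y ^ 2 / 2 ≤ 2 * y / (y + 2) := by
    rw [le_div_iff₀ (by positivity)]
    nlinarith [pow_nonneg hy0 3]
  have h5 : (r ^ 2 + 2 * r * c + a ^ 2) / (2 * (w + a ^ 2 + c)) - r ^ 2 / (2 * w)
      = a ^ 2 / (2 * (w + a ^ 2 + c)) + y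
        - (a ^ 2 * q ^ 2 * w + 2 * y * (a ^ 2 + c)) / (2 * (w + a ^ 2 + c)) := by
    have : 0 < w + a ^ 2 + c := by positivity
    rw [hy, hrq]
    field_simp
    ring
  linarith

/-- Completing the square in `r` leaves `(A - b) b² (2 + b)² / 4`. AM-GM gives `(A - b) b² ≤ 4 A³ /
27`, and `2 + b ≤ 3`, so this is at most `A² / 3`, exactly the share contained in the first term. -/
theorem overshoot_poly_nonneg {A b r : ℝ} (hb : 0 ≤ b) (h : b ≤ A) (hA1 : A ≤ 1) (hbr : b ≤ r) :
    0 ≤ A * (2 * (r - b) + A) / 3 + (A - b ^ 2) * r ^ 2 - (A - b) * b * r * (2 + b) := by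
  have hA0 : 0 ≤ A := hb.trans h
  have hAb : 0 ≤ A - b := by linarith
  have f1 : (A - b) * r ^ 2 ≤ (A - b ^ 2) * r ^ 2 := by
    gcongr
    nlinarith
  have f2 : 0 ≤ (A - b) * (r - b * (2 + b) / 2) ^ 2 := mul_nonneg hAb (sq_nonneg _)
  have f3 : (A - b) * b ^ 2 ≤ 4 / 27 * A ^ 2 := by
    have g1 : 4 / 27 * A ^ 3 - (A - b) * b ^ 2 = (3 * b - 2 * A) ^ 2 * (3 * b + A) / 27 := by ring
    have g2 : 0 ≤ (3 * b - 2 * A) ^ 2 * (3 * b + A) / 27 := by positivity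
    have g3 : A ^ 3 ≤ A ^ 2 := pow_le_pow_of_le_one hA0 hA1 (by norm_num)
    linarith
  have f4 : (A - b) * b ^ 2 * (2 + b) ^ 2 ≤ (A - b) * b ^ 2 * 3 ^ 2 := by
    gcongr
    linarith
  have f5 : 0 ≤ A * (r - b) := mul_nonneg hA0 (by linarith)
  have f6 : (A - b) * r ^ 2 - (A - b) * b * r * (2 + b)
      = (A - b) * (r - b * (2 + b) / 2) ^ 2 - (A - b) * b ^ 2 * (2 + b) ^ 2 / 4 := by ring
  linarith

/-- The difference of the sides is affine in `x`, so only `x = 0` and `x = 1` matter; each leaves a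
polynomial in `t`. The variant below works the same way. -/
theorem reversal_poly_le {x t : ℝ} (hx : 0 ≤ x) (hx1 : x ≤ 1) (ht : 0 ≤ t) :
    2 * (1 - t ^ 2) * (x - 1 + 2 * t) ≤ x + 2 * t := by
  have h0 : 0 ≤ 1 - 2 * t + 4 * t ^ 3 := by
    nlinarith [mul_nonneg ht (sq_nonneg (t - 2 / 5)), sq_nonneg (t - 2 / 5)]
  have h1 : 0 ≤ 2 * t - 2 * (1 - t ^ 2) * (2 * t - 1) := by
    nlinarith [mul_nonneg ht (sq_nonneg (t - 2 / 5)), sq_nonneg (t - 1 / 2)]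
  have e : x + 2 * t - 2 * (1 - t ^ 2) * (x - 1 + 2 * t)
      = x * (1 - 2 * t + 4 * t ^ 3) + (1 - x) * (2 * t - 2 * (1 - t ^ 2) * (2 * t - 1)) := by ring
  have : 0 ≤ 1 - x := by linarith
  have := add_nonneg (mul_nonneg hx h0) (mul_nonneg this h1)
  linarith

theorem reversal_poly_le' {x t : ℝ} (hx : 0 ≤ x) (hx1 : x ≤ 1) (ht : 0 ≤ t) :
    (1 + 2 * t) * (1 - t ^ 2) * (x - 1 + 2 * t) ≤ x + 2 * t := by
  have h0 : 0 ≤ 1 - 2 * t + 2 * t ^ 3 := by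
    nlinarith [mul_nonneg ht (sq_nonneg (t - 3 / 5)), sq_nonneg (t - 3 / 5)]
  have h1 : 0 ≤ 2 * t - (4 * t ^ 2 - 1) * (1 - t ^ 2) := by
    nlinarith [sq_nonneg (t ^ 2 - 5 / 8), sq_nonneg (t - 3 / 4), sq_nonneg t]
  have e : x + 2 * t - (1 + 2 * t) * (1 - t ^ 2) * (x - 1 + 2 * t)
      = x * ((1 + 2 * t) * (1 - 2 * t + 2 * t ^ 3))
        + (1 - x) * (2 * t - (4 * t ^ 2 - 1) * (1 - t ^ 2)) := by ring
  have : 0 ≤ 1 - x := by linarith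
  have := add_nonneg (mul_nonneg hx (mul_nonneg (by positivity : 0 ≤ 1 + 2 * t) h0))
    (mul_nonneg this h1)
  linarith

/-- Cleared-denominator form of the overshooting case. After `b` is replaced by `a`, the
substitution `r = (1 - t) a` leaves a polynomial inequality in `a` and `t`. -/
theorem reversal_poly_le_mul {r v a b : ℝ} (hr : 0 ≤ r) (hv : 1 ≤ v) (ha1 : a ≤ 1)
    (hba : b ≤ a) (hrb : r < b) :
    (r * (2 * b - r) * (a ^ 2 + a - 2 * r)) * (2 * v + a ^ 2)
      ≤ (a ^ 2 * (a ^ 2 + 2 * (a - r))) * (v + r) := by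
  have ha : 0 < a := by linarith
  have hV : 0 < 2 * v + a ^ 2 := by positivity
  have hR : 0 ≤ (a ^ 2 * (a ^ 2 + 2 * (a - r))) * (v + r) := by
    have : 0 ≤ a - r := by linarith
    positivity
  rcases le_total (a ^ 2 + a - 2 * r) 0 with h | h
  · have h1 : 0 ≤ r * (2 * b - r) := mul_nonneg hr (by linarith)
    nlinarith [mul_nonneg h1 (neg_nonneg.2 h)]
  · obtain ⟨t, ht⟩ : ∃ t, t = 1 - r / a := ⟨_, rfl⟩
    have hrt : r = (1 - t) * a := by rw [ht]; field_simp; ring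
    have ht0 : 0 ≤ t := by
      rw [ht, sub_nonneg, div_le_one ha]; linarith
    have h1 : r * (2 * b - r) * (a ^ 2 + a - 2 * r) * (2 * v + a ^ 2)
        ≤ r * (2 * a - r) * (a ^ 2 + a - 2 * r) * (2 * v + a ^ 2) := by gcongr
    have h2 : r * (2 * a - r) * (a ^ 2 + a - 2 * r)
        = a ^ 3 * ((1 - t ^ 2) * (a - 1 + 2 * t)) := by rw [hrt]; ring
    have h3 : a ^ 2 * (a ^ 2 + 2 * (a - r)) = a ^ 3 * (a + 2 * t) := by rw [hrt]; ring
    have h4 : 0 ≤ (1 - t ^ 2) * (a - 1 + 2 * t) := by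
      have g1 : 0 ≤ r * (2 * a - r) * (a ^ 2 + a - 2 * r) :=
        mul_nonneg (mul_nonneg hr (by linarith)) h
      rw [h2] at g1
      exact nonneg_of_mul_nonneg_right g1 (by positivity)
    refine h1.trans ?_
    rw [h2, h3, mul_assoc, mul_assoc (a ^ 3)]
    refine mul_le_mul_of_nonneg_left ?_ (by positivity)
    have hvr : 0 ≤ v + r := by linarith
    -- The ratio `(2v + a²) / (v + r)` is at most `2` in the first case. In the second, `a² - 2r ≤
    -- 2t - 1` and `v + r ≥ 1` bound it by `1 + 2t`. Each case has its own polynomial inequality.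
    rcases le_total (a ^ 2) (2 * r) with h5 | h5
    · have h6 := mul_le_mul_of_nonneg_right (reversal_poly_le ha.le ha1 ht0) hvr
      have h7 : (1 - t ^ 2) * (a - 1 + 2 * t) * (2 * v + a ^ 2)
          ≤ (1 - t ^ 2) * (a - 1 + 2 * t) * (2 * (v + r)) := by
        gcongr
        linarith
      linarith
    · have h6 := mul_le_mul_of_nonneg_right (reversal_poly_le' ha.le ha1 ht0) hvr
      have h7 : (1 - t ^ 2) * (a - 1 + 2 * t) * (2 * v + a ^ 2)
          ≤ (1 - t ^ 2) * (a - 1 + 2 * t) * ((1 + 2 * t) * (v + r)) := by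
        refine mul_le_mul_of_nonneg_left ?_ h4
        have g1 : 2 * (1 - t) ≤ a := by
          rw [hrt] at h5
          nlinarith
        have g2 : a ^ 2 - 2 * r ≤ 2 * t - 1 := by rw [hrt]; nlinarith
        nlinarith
      linarith

/-- As `exponent_step_of_nonneg`, for a step against the state that does not overshoot it. -/
theorem exponent_step_of_le {r v a b ρ : ℝ} (hv : 1 ≤ v) (ha : 0 ≤ a) (ha1 : a ≤ 1)
    (hb : 0 ≤ b) (hba : b ≤ a) (hbr : b ≤ r) (hρ0 : 0 ≤ ρ)
    (hρ : ρ ^ 2 = r ^ 2 - 2 * r * b + a ^ 2) :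
    ρ ^ 2 / (2 * (v + a ^ 2 + ρ)) - r ^ 2 / (2 * (v + r))
      ≤ a ^ 2 / (2 * v + a ^ 2)
        + Real.log (1 - b * (r / (v + r) - (r / (v + r)) ^ 2 / 2)) := by
  have hr : 0 ≤ r := hb.trans hbr
  obtain ⟨w, hw⟩ : ∃ w, w = v + r := ⟨_, rfl⟩
  obtain ⟨q, hq⟩ : ∃ q, q = r / w := ⟨_, rfl⟩
  have hw0 : 0 < w := by linarith
  have hrq : r = q * w := by rw [hq]; field_simp
  have hq0 : 0 ≤ q := by rw [hq]; positivity
  have hq1 : q ≤ 1 := by rw [hq, div_le_one hw0]; linarith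
  rw [← hw, ← hq]
  have hlog := neg_log_one_sub_mul_le hb (hba.trans ha1) hq0 hq1
  obtain ⟨y, hy⟩ : ∃ y, y = b * (q - q ^ 2 / 2) := ⟨_, rfl⟩
  rw [← hy] at hlog ⊢
  have hz0 : 0 ≤ q - q ^ 2 / 2 := by nlinarith
  have hy0 : 0 ≤ y := by rw [hy]; positivity
  have hyb : y ≤ b * q := by
    rw [hy]; gcongr; nlinarith
  have hρr : r - b ≤ ρ := by
    refine (le_abs_self _).trans (abs_le_of_sq_le_sq ?_ hρ0)
    nlinarith
  obtain ⟨D, hD⟩ : ∃ D, D = w + a ^ 2 - b := ⟨_, rfl⟩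
  have hD0 : 0 < D := by nlinarith
  have h1 : ρ ^ 2 / (2 * (v + a ^ 2 + ρ)) ≤ (r ^ 2 - 2 * r * b + a ^ 2) / (2 * D) := by
    rw [← hρ]
    apply div_le_div_of_nonneg_left (by positivity) (by positivity)
    linarith
  have h5 : (r ^ 2 - 2 * r * b + a ^ 2) / (2 * D) - r ^ 2 / (2 * w)
      = -y + (a ^ 2 - a ^ 2 * q ^ 2 * w + 2 * y * (a ^ 2 - b)) / (2 * D) := by
    rw [hy, hrq]
    field_simp
    rw [hD]
    ring
  have key : (a ^ 2 - a ^ 2 * q ^ 2 * w + 2 * y * (a ^ 2 - b)) / (2 * D)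
      ≤ a ^ 2 / (2 * v + a ^ 2) - b ^ 2 * q ^ 2 / 2 := by
    have hV : 0 < 2 * v + a ^ 2 := by positivity
    have hab : b ^ 2 ≤ a ^ 2 := by gcongr
    rw [div_le_iff₀ (by positivity)]
    have e0 : a ^ 2 / (2 * v + a ^ 2) * (2 * D)
        = a ^ 2 + a ^ 2 * (2 * (r - b) + a ^ 2) / (2 * v + a ^ 2) := by
      field_simp
      rw [hD, hw]
      ring
    have e1 : 0 ≤ a ^ 2 * (2 * (r - b) + a ^ 2) / (2 * v + a ^ 2) := by
      have : 0 ≤ r - b := by linarith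
      positivity
    -- If `a² ≤ b`, every term has a favourable sign and the gain `e1` is not needed. Otherwise the
    -- positive term `2y(a² - b)` has to be absorbed by that gain.
    rcases le_total (a ^ 2) b with h | h
    · have e2 : b ^ 2 * q ^ 2 * w ≤ a ^ 2 * q ^ 2 * w := by gcongr
      have e3 : 0 ≤ y * (b - a ^ 2) := mul_nonneg hy0 (by linarith)
      have e4 : 0 ≤ b ^ 2 * q ^ 2 * (b - a ^ 2) := mul_nonneg (by positivity) (by linarith)
      rw [sub_mul, e0, hD]
      linarith
    · obtain ⟨A, hA⟩ : ∃ A, A = a ^ 2 := ⟨_, rfl⟩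
      rw [← hA] at h hD e0 e1 hV ⊢
      have hA1 : A ≤ 1 := by rw [hA]; exact pow_le_one₀ ha ha1
      have hA0 : 0 ≤ A := hb.trans h
      have e2 : A * (2 * (r - b) + A) / 3 ≤ A * (2 * (r - b) + A) / (2 * v + A) * w := by
        have : 0 ≤ A * (2 * (r - b) + A) := by
          have : 0 ≤ r - b := by linarith
          positivity
        rw [div_mul_eq_mul_div (A * (2 * (r - b) + A)), div_le_div_iff₀ three_pos hV,
          mul_assoc (A * (2 * (r - b) + A)) w 3]
        apply mul_le_mul_of_nonneg_left _ this
        linarith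
      have e3 := overshoot_poly_nonneg hb h hA1 hbr
      have e4 : y * w ≤ b * r := by
        rw [hrq, ← mul_assoc]
        exact mul_le_mul_of_nonneg_right hyb hw0.le
      have e5 : q * r ≤ r := mul_le_of_le_one_left hr hq1
      rw [sub_mul, e0, hD]
      refine le_of_mul_le_mul_right ?_ hw0
      have e6 : y * w * (A - b) ≤ b * r * (A - b) :=
        mul_le_mul_of_nonneg_right e4 (by linarith)
      have e7 : b ^ 2 * (A - b) * (q * r) ≤ b ^ 2 * (A - b) * r :=
        mul_le_mul_of_nonneg_left e5 (mul_nonneg (sq_nonneg _) (by linarith))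
      have e8 : q ^ 2 * w * w = r ^ 2 := by rw [hrq]; ring
      have e9 : q ^ 2 * w = q * r := by rw [hrq]; ring
      have l1 : (A - A * q ^ 2 * w + 2 * y * (A - b)) * w
          = A * w - A * (q ^ 2 * w * w) + 2 * (y * w * (A - b)) := by ring
      have l2 : (A + A * (2 * (r - b) + A) / (2 * v + A) - b ^ 2 * q ^ 2 / 2 * (2 * (w + A - b))) * w
          = A * w + A * (2 * (r - b) + A) / (2 * v + A) * w
            - b ^ 2 * (q ^ 2 * w * w) - b ^ 2 * (A - b) * (q ^ 2 * w) := by ring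
      rw [l1, l2, e8, e9]
      linarith
  linarith

/-- As `exponent_step_of_nonneg`, for a step against the state that overshoots it. -/
theorem exponent_step_of_lt {r v a b ρ : ℝ} (hr : 0 ≤ r) (hv : 1 ≤ v) (ha1 : a ≤ 1)
    (hba : b ≤ a) (hrb : r < b) (hρ0 : 0 ≤ ρ)
    (hρ : ρ ^ 2 = r ^ 2 - 2 * r * b + a ^ 2) :
    ρ ^ 2 / (2 * (v + a ^ 2 + ρ)) - r ^ 2 / (2 * (v + r))
      ≤ a ^ 2 / (2 * v + a ^ 2)
        + Real.log (1 - b * (r / (v + r) - (r / (v + r)) ^ 2 / 2)) := by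
  have hb : 0 ≤ b := hr.trans hrb.le
  have ha : 0 ≤ a := hb.trans hba
  obtain ⟨w, hw⟩ : ∃ w, w = v + r := ⟨_, rfl⟩
  obtain ⟨q, hq⟩ : ∃ q, q = r / w := ⟨_, rfl⟩
  have hw0 : 0 < w := by linarith
  have hq0 : 0 ≤ q := by rw [hq]; positivity
  have hq1 : q ≤ 1 := by rw [hq, div_le_one hw0]; linarith
  rw [← hw, ← hq]
  have hlog := neg_log_one_sub_mul_le hb (hba.trans ha1) hq0 hq1
  have hlog' : -Real.log (1 - b * (q - q ^ 2 / 2)) ≤ b * q := by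
    have : b ^ 2 * q ^ 2 ≤ b * q ^ 2 := by
      gcongr
      nlinarith
    linarith
  -- After an overshoot the useful lower bound on the new norm is the reverse triangle inequality,
  -- not `r - b`, which is now negative.
  have hρr : a - r ≤ ρ := by
    refine (le_abs_self _).trans (abs_le_of_sq_le_sq ?_ hρ0)
    nlinarith
  obtain ⟨K, hK⟩ : ∃ K, K = v + a ^ 2 + a - r := ⟨_, rfl⟩
  have hK0 : 0 < K := by nlinarith
  have h1 : ρ ^ 2 / (2 * (v + a ^ 2 + ρ)) ≤ (r ^ 2 - 2 * r * b + a ^ 2) / (2 * K) := by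
    rw [← hρ]
    apply div_le_div_of_nonneg_left (by positivity) (by positivity)
    linarith
  have hV : 0 < 2 * v + a ^ 2 := by positivity
  have key := reversal_poly_le_mul hr hv ha1 hba hrb
  rw [← hw] at key
  have e1 : r * (2 * b - r) * (1 / (2 * w) - 1 / (2 * K))
      = (r * (2 * b - r) * (a ^ 2 + a - 2 * r)) / w / (2 * K) := by
    field_simp
    rw [hK, hw]
    ring
  have e2 : a ^ 2 * (1 / (2 * v + a ^ 2) - 1 / (2 * K))
      = (a ^ 2 * (a ^ 2 + 2 * (a - r))) / (2 * v + a ^ 2) / (2 * K) := by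
    field_simp
    rw [hK]
    ring
  have e3 : r * (2 * b - r) * (1 / (2 * w) - 1 / (2 * K))
      ≤ a ^ 2 * (1 / (2 * v + a ^ 2) - 1 / (2 * K)) := by
    rw [e1, e2]
    gcongr ?_ / (2 * K)
    rwa [div_le_div_iff₀ hw0 hV]
  have e4 : (r ^ 2 - 2 * r * b + a ^ 2) / (2 * K) - r ^ 2 / (2 * w) + b * q
      - a ^ 2 / (2 * v + a ^ 2)
      = r * (2 * b - r) * (1 / (2 * w) - 1 / (2 * K))
        - a ^ 2 * (1 / (2 * v + a ^ 2) - 1 / (2 * K)) := by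
    rw [hq]
    field_simp
    ring
  linarith

/-- In units where `G = 1`: `r` and `ρ` are the norms of the gradient sum before and after the step,
`a` is the step length and `c` its component along the old sum. With `q = r / (v + r)`, `q - q² / 2`
is the derivative of `r² / (2(v + r))` in `r`. -/
theorem exponent_step {r v a c ρ : ℝ} (hr : 0 ≤ r) (hv : 1 ≤ v) (ha1 : a ≤ 1)
    (hca : |c| ≤ a) (hρ0 : 0 ≤ ρ) (hρ : ρ ^ 2 = r ^ 2 + 2 * r * c + a ^ 2) :
    ρ ^ 2 / (2 * (v + a ^ 2 + ρ)) - r ^ 2 / (2 * (v + r))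
      ≤ a ^ 2 / (2 * v + a ^ 2)
        + Real.log (1 + c * (r / (v + r) - (r / (v + r)) ^ 2 / 2)) := by
  obtain ⟨h1, h2⟩ := abs_le.1 hca
  have ha : 0 ≤ a := (abs_nonneg c).trans hca
  rcases le_total 0 c with hc | hc
  · exact exponent_step_of_nonneg hr hv ha ha1 hc h2 hρ0 hρ
  · have e : 1 + c * (r / (v + r) - (r / (v + r)) ^ 2 / 2)
        = 1 - (-c) * (r / (v + r) - (r / (v + r)) ^ 2 / 2) := by ring
    have hρ' : ρ ^ 2 = r ^ 2 - 2 * r * (-c) + a ^ 2 := by rw [hρ]; ring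
    rw [e]
    rcases le_or_gt (-c) r with h | h
    · exact exponent_step_of_le hv ha ha1 (by linarith) (by linarith) h hρ0 hρ'
    · exact exponent_step_of_lt hr hv ha1 (by linarith) h hρ0 hρ'

variable {d : ℕ} {G : ℝ}

/-! ### The FreeGrad potential -/

/-- The FreeGrad potential at the gradient sum `s` and the variance `v`, for `ε = 1`. -/
def potential (G : ℝ) (s : Vec d) (v : ℝ) : ℝ :=
  G ^ 2 * Real.exp (‖s‖ ^ 2 / (2 * v + 2 * G * ‖s‖)) / √v

theorem exp_exponent_step (hG : 0 < G) {s g : Vec d} {v : ℝ} (hv : G ^ 2 ≤ v) (hg : ‖g‖ ≤ G) :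
    Real.exp (‖s + g‖ ^ 2 / (2 * (v + ‖g‖ ^ 2) + 2 * G * ‖s + g‖))
      ≤ Real.exp (‖s‖ ^ 2 / (2 * v + 2 * G * ‖s‖)) * √(1 + ‖g‖ ^ 2 / v)
        * (1 + inner ℝ g s * ((2 * v + G * ‖s‖) / (2 * (v + G * ‖s‖) ^ 2))) := by
  have hv0 : 0 < v := lt_of_lt_of_le (by positivity) hv
  obtain ⟨n, hn⟩ : ∃ n, n = ‖s‖ := ⟨_, rfl⟩
  obtain ⟨γ, hγ⟩ : ∃ γ, γ = ‖g‖ := ⟨_, rfl⟩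
  obtain ⟨σ, hσ⟩ : ∃ σ, σ = ‖s + g‖ := ⟨_, rfl⟩
  obtain ⟨p, hp⟩ : ∃ p, p = inner ℝ g s := ⟨_, rfl⟩
  have hn0 : 0 ≤ n := hn ▸ norm_nonneg _
  have hγ0 : 0 ≤ γ := hγ ▸ norm_nonneg _
  have hσ0 : 0 ≤ σ := hσ ▸ norm_nonneg _
  have hpn : |p| ≤ γ * n := by rw [hp, hγ, hn]; exact abs_real_inner_le_norm _ _
  have hσ2 : σ ^ 2 = n ^ 2 + 2 * p + γ ^ 2 := by
    rw [hσ, hn, hp, hγ, norm_add_sq_real, real_inner_comm]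
  rw [← hγ] at hg
  rw [← hn, ← hγ, ← hσ, ← hp]
  -- For `s = 0` division by zero makes `c = 0`, which is consistent because then `p = 0`.
  obtain ⟨c, hc⟩ : ∃ c, c = p / (G * n) := ⟨_, rfl⟩
  have hcn : n * c = p / G := by
    rcases hn0.eq_or_lt with h | h
    · rw [← h, mul_zero] at hpn
      rw [← h, abs_nonpos_iff.1 hpn]
      simp
    · rw [hc]; field_simp
  have hca : |c| ≤ γ / G := by
    rw [hc, abs_div, abs_of_nonneg (by positivity : 0 ≤ G * n)]
    rcases hn0.eq_or_lt with h | h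
    · rw [← h, mul_zero, div_zero]; positivity
    · rw [div_le_div_iff₀ (by positivity) hG]
      nlinarith
  have hγG : γ / G ≤ 1 := (div_le_one hG).2 hg
  have step := exponent_step (r := n / G) (v := v / G ^ 2) (a := γ / G) (c := c) (ρ := σ / G)
    (by positivity) ((one_le_div (by positivity)).2 hv) hγG hca
    (by positivity) (by
      have e : 2 * (n / G) * c = 2 * p / G ^ 2 := by
        rw [show 2 * (n / G) * c = 2 * (n * c) / G by ring, hcn]; field_simp
      rw [e, div_pow, hσ2]
      field_simp)
  have e1 : (σ / G) ^ 2 / (2 * (v / G ^ 2 + (γ / G) ^ 2 + σ / G))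
      = σ ^ 2 / (2 * (v + γ ^ 2) + 2 * G * σ) := by field_simp
  have e2 : (n / G) ^ 2 / (2 * (v / G ^ 2 + n / G)) = n ^ 2 / (2 * v + 2 * G * n) := by
    field_simp
  have e3 : (γ / G) ^ 2 / (2 * (v / G ^ 2) + (γ / G) ^ 2) = γ ^ 2 / (2 * v + γ ^ 2) := by
    field_simp
  obtain ⟨q, hq⟩ : ∃ q, q = n / G / (v / G ^ 2 + n / G) := ⟨_, rfl⟩
  have hq0 : 0 ≤ q := by rw [hq]; positivity
  have hq1 : q ≤ 1 := by
    rw [hq, div_le_one (by positivity)]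
    have : 0 < v / G ^ 2 := by positivity
    linarith
  have e4 : 1 + c * (q - q ^ 2 / 2)
      = 1 + p * ((2 * v + G * n) / (2 * (v + G * n) ^ 2)) := by
    have e : q - q ^ 2 / 2 = n * (G * (2 * v + G * n) / (2 * (v + G * n) ^ 2)) := by
      rw [hq]
      field_simp
      ring
    rw [e, ← mul_assoc, mul_comm c, hcn]
    field_simp
  have hY : 0 < 1 + c * (q - q ^ 2 / 2) := by
    have h1 := (abs_le.1 (hca.trans hγG)).1
    have h2 : 0 ≤ q - q ^ 2 / 2 := by nlinarith
    nlinarith [sq_nonneg (q - 1)]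
  rw [← hq, e1, e2, e3] at step
  -- Exponentiated, this is the growth factor of `√v`, so the normalization of the potential pays
  -- for the second-order term.
  have hlog : γ ^ 2 / (2 * v + γ ^ 2) ≤ Real.log (1 + γ ^ 2 / v) / 2 := by
    have h := Real.le_log_one_add_of_nonneg (x := γ ^ 2 / v) (by positivity)
    have e : 2 * (γ ^ 2 / v) / (γ ^ 2 / v + 2) = 2 * (γ ^ 2 / (2 * v + γ ^ 2)) := by
      field_simp
      ring
    linarith
  have hx : 0 < 1 + γ ^ 2 / v := by positivity
  rw [← e4]
  calc Real.exp (σ ^ 2 / (2 * (v + γ ^ 2) + 2 * G * σ))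
      ≤ Real.exp (n ^ 2 / (2 * v + 2 * G * n) + Real.log (1 + γ ^ 2 / v) / 2
          + Real.log (1 + c * (q - q ^ 2 / 2))) := by
        apply Real.exp_le_exp.2; linarith
    _ = _ := by
        rw [Real.exp_add, Real.exp_add, Real.exp_log hY, Real.exp_half, Real.exp_log hx]

/-- The factor of `inner ℝ g s` is the one FreeGrad uses for `ε = 1`, up to sign: the added term is
`⟨∇ₛ potential, g⟩`. -/
theorem potential_step (hG : 0 < G) {s g : Vec d} {v : ℝ} (hv : G ^ 2 ≤ v) (hg : ‖g‖ ≤ G) :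
    potential G (s + g) (v + ‖g‖ ^ 2) ≤ potential G s v
      + (2 * v + G * ‖s‖) * G ^ 2 / (2 * (v + G * ‖s‖) ^ 2 * √v)
        * Real.exp (‖s‖ ^ 2 / (2 * v + 2 * G * ‖s‖)) * inner ℝ g s := by
  have hv0 : 0 < v := lt_of_lt_of_le (by positivity) hv
  have h := exp_exponent_step hG hv hg (s := s)
  have hs : √(v + ‖g‖ ^ 2) = √v * √(1 + ‖g‖ ^ 2 / v) := by
    rw [← Real.sqrt_mul hv0.le]
    congr 1
    field_simp
  have hsv : 0 < √v := Real.sqrt_pos.2 hv0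
  have hs1 : 0 < √(1 + ‖g‖ ^ 2 / v) := Real.sqrt_pos.2 (by positivity)
  unfold potential
  rw [hs, div_le_iff₀ (by positivity)]
  refine (mul_le_mul_of_nonneg_left h (sq_nonneg G)).trans (le_of_eq ?_)
  have : 0 < v + G * ‖s‖ := by positivity
  field_simp

/-- The variance `G² + ∑ ‖g‖²` of a list of gradients. -/
def listVariance (G : ℝ) (gs : List (Vec d)) : ℝ := G ^ 2 + (gs.map fun g => ‖g‖ ^ 2).sum

theorem le_listVariance (gs : List (Vec d)) : G ^ 2 ≤ listVariance G gs := by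
  refine le_add_of_nonneg_right (List.sum_nonneg fun x hx => ?_)
  obtain ⟨g, -, rfl⟩ := List.mem_map.1 hx
  positivity

theorem listVariance_le {gs : List (Vec d)} (hgs : ∀ g ∈ gs, ‖g‖ ≤ G) :
    listVariance G gs ≤ G ^ 2 * (gs.length + 1) := by
  have h : (gs.map fun g => ‖g‖ ^ 2).sum ≤ gs.length * G ^ 2 := by
    have := List.sum_le_card_nsmul (gs.map fun g => ‖g‖ ^ 2) (G ^ 2) fun x hx => by
      obtain ⟨g, hg, rfl⟩ := List.mem_map.1 hx
      have := hgs g hg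
      gcongr
    simpa using this
  unfold listVariance
  linarith

theorem norm_list_sum_le {gs : List (Vec d)} (hgs : ∀ g ∈ gs, ‖g‖ ≤ G) :
    ‖gs.sum‖ ≤ G * gs.length := by
  induction gs with
  | nil => simp
  | cons g gs ih =>
    rw [List.sum_cons, List.length_cons]
    push_cast
    have h1 := ih fun x hx => hgs x (List.mem_cons_of_mem _ hx)
    have h2 := hgs g List.mem_cons_self
    linarith [norm_add_le g gs.sum]

theorem inner_freeGrad_le (hG : 0 < G) {ε : ℝ} (hε : 0 ≤ ε) (gs : List (Vec d)) {g : Vec d}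
    (hg : ‖g‖ ≤ G) :
    inner ℝ g (freeGrad ε G gs) ≤ ε * (potential G gs.sum (listVariance G gs)
      - potential G (gs ++ [g]).sum (listVariance G (gs ++ [g]))) := by
  have h := mul_le_mul_of_nonneg_left (potential_step hG (le_listVariance gs) hg (s := gs.sum)) hε
  have e1 : (gs ++ [g]).sum = gs.sum + g := by simp
  have e2 : listVariance G (gs ++ [g]) = listVariance G gs + ‖g‖ ^ 2 := by
    simp [listVariance, add_assoc]
  rw [e1, e2]
  have e3 : inner ℝ g (freeGrad ε G gs)
      = -ε * ((2 * listVariance G gs + G * ‖gs.sum‖) * G ^ 2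
        / (2 * (listVariance G gs + G * ‖gs.sum‖) ^ 2 * √(listVariance G gs))
        * Real.exp (‖gs.sum‖ ^ 2 / (2 * listVariance G gs + 2 * G * ‖gs.sum‖))
        * inner ℝ g gs.sum) := by
    unfold freeGrad
    rw [inner_smul_right]
    unfold listVariance
    ring
  rw [e3]
  linarith

/-- A Fenchel-type bound on the conjugate of the FreeGrad potential. -/
theorem mul_sub_potential_le (hG : 0 < G) {ε U L K v : ℝ} {s : Vec d} (hε : 0 < ε) (hU : 0 ≤ U)
    (hK : 0 ≤ K) (hL : Real.log (1 + (K + 1) ^ 2 * U / ε) ≤ L)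
    (hv : G ^ 2 ≤ v) (hv' : v ≤ G ^ 2 * (K + 1)) (hs : ‖s‖ ≤ G * K) :
    ‖s‖ * U - ε * potential G s v ≤ U * G * √(K + 1) * (2 * L + √(2 * L)) := by
  have hv0 : 0 < v := lt_of_lt_of_le (by positivity) hv
  have hx : 0 ≤ (K + 1) ^ 2 * U / ε := by positivity
  have hL0 : 0 ≤ L := (Real.log_nonneg (by linarith)).trans hL
  have hsv : √v ≤ G * √(K + 1) := by
    refine (Real.sqrt_le_sqrt hv').trans (le_of_eq ?_)
    rw [Real.sqrt_mul (sq_nonneg G), Real.sqrt_sq hG.le]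
  have hK1 : 1 ≤ √(K + 1) := Real.one_le_sqrt.2 (by linarith)
  have hn := norm_nonneg s
  -- Either the exponent is at least `L` and the potential alone dominates `‖s‖ * U`, one factor `K
  -- + 1` paying for `‖s‖` and the other for `√v`; or the quadratic inequality bounds `‖s‖`
  -- directly.
  rcases le_or_gt (2 * L * (v + G * ‖s‖)) (‖s‖ ^ 2) with h | h
  · have h1 : L ≤ ‖s‖ ^ 2 / (2 * v + 2 * G * ‖s‖) := by
      rw [le_div_iff₀ (by positivity)]
      linarith
    have h2 : (K + 1) ^ 2 * U / ε ≤ Real.exp (‖s‖ ^ 2 / (2 * v + 2 * G * ‖s‖)) := by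
      have := (Real.log_le_iff_le_exp (by linarith)).1 (hL.trans h1)
      linarith
    have h3 : ‖s‖ * U ≤ ε * potential G s v := by
      have hsK : √v ≤ G * (K + 1) := by
        refine hsv.trans (mul_le_mul_of_nonneg_left ?_ hG.le)
        exact (Real.sqrt_le_left (by linarith)).2 (by nlinarith)
      calc ‖s‖ * U ≤ G * (K + 1) * U := by gcongr; linarith
        _ = ε * (G ^ 2 * ((K + 1) ^ 2 * U / ε) / (G * (K + 1))) := by
          have : 0 < K + 1 := by linarith
          field_simp
        _ ≤ ε * potential G s v := by
          unfold potential
          gcongr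
    have : 0 ≤ U * G * √(K + 1) * (2 * L + √(2 * L)) := by positivity
    linarith
  · have h1 : ‖s‖ ≤ 2 * L * G + √(2 * L) * √v := by
      by_contra! hc
      rw [← Real.sqrt_mul (by positivity)] at hc
      have hr := Real.sqrt_nonneg (2 * L * v)
      have hr2 := Real.sq_sqrt (by positivity : 0 ≤ 2 * L * v)
      have h0 : 0 ≤ 2 * L * G := by positivity
      nlinarith
    have h2 : ‖s‖ ≤ G * √(K + 1) * (2 * L + √(2 * L)) := by
      have a1 : 2 * L * G * 1 ≤ 2 * L * G * √(K + 1) := by gcongr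
      have a2 : √(2 * L) * √v ≤ √(2 * L) * (G * √(K + 1)) := by gcongr
      linarith
    have h3 : 0 ≤ ε * potential G s v := by unfold potential; positivity
    have h4 := mul_le_mul_of_nonneg_right h2 hU
    linarith

/-! ### Regret of the copy of FreeGrad attached to a feature -/

/-- The first `n` terms of a sequence, as a list. -/
def initSeg (g : ℕ → Vec d) (n : ℕ) : List (Vec d) := (List.range n).map g

@[simp] theorem length_initSeg (g : ℕ → Vec d) (n : ℕ) : (initSeg g n).length = n := by
  simp [initSeg]

theorem initSeg_succ (g : ℕ → Vec d) (n : ℕ) : initSeg g (n + 1) = initSeg g n ++ [g n] := by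
  simp [initSeg, List.range_succ]

theorem initSeg_drop (g : ℕ → Vec d) (n k : ℕ) :
    (initSeg g (k + n)).drop k = initSeg (fun i => g (k + i)) n := by
  unfold initSeg
  rw [List.range_add, List.map_append, List.drop_left' (by simp), List.map_map]
  rfl

theorem surrogateGrads_initSeg_succ (h : ℕ → ℝ) (g : ℕ → Vec d) (n : ℕ) :
    surrogateGrads h (initSeg g (n + 1)) = surrogateGrads h (initSeg g n)
      ++ (if h (n + 1) ≠ 0 then [h (n + 1) • g n] else []) := by
  unfold surrogateGrads
  rw [initSeg_succ, List.zipIdx_append, List.filterMap_append, length_initSeg, add_comm 1 n]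
  by_cases hn : h (n + 1) = 0 <;> simp [hn]

theorem surrogateGrads_initSeg_zero (h : ℕ → ℝ) (g : ℕ → Vec d) :
    surrogateGrads h (initSeg g 0) = [] := by
  simp [surrogateGrads, initSeg]

theorem length_surrogateGrads (h : ℕ → ℝ) (g : ℕ → Vec d) (n : ℕ) :
    (surrogateGrads h (initSeg g n)).length
      = ((Finset.range n).filter fun i => h (i + 1) ≠ 0).card := by
  induction n with
  | zero => simp [surrogateGrads_initSeg_zero]
  | succ n ih =>
    rw [surrogateGrads_initSeg_succ, List.length_append, ih, Finset.range_add_one,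
      Finset.filter_insert]
    by_cases hn : h (n + 1) = 0 <;> simp [hn]

theorem sum_surrogateGrads (h : ℕ → ℝ) (g : ℕ → Vec d) (n : ℕ) :
    (surrogateGrads h (initSeg g n)).sum = ∑ i ∈ Finset.range n, h (i + 1) • g i := by
  induction n with
  | zero => simp [surrogateGrads_initSeg_zero]
  | succ n ih =>
    rw [surrogateGrads_initSeg_succ, List.sum_append, ih, Finset.sum_range_succ]
    by_cases hn : h (n + 1) = 0 <;> simp [hn]

theorem norm_smul_le_of_abs_le_one {a : ℝ} {g : Vec d} (ha : |a| ≤ 1) (hg : ‖g‖ ≤ G) :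
    ‖a • g‖ ≤ G := by
  rw [norm_smul, Real.norm_eq_abs]
  exact (mul_le_of_le_one_left (norm_nonneg g) ha).trans hg

theorem norm_le_of_mem_surrogateGrads {h : ℕ → ℝ} (hh : ∀ i, |h i| ≤ 1) {g : ℕ → Vec d}
    (hg : ∀ i, ‖g i‖ ≤ G) (n : ℕ) : ∀ x ∈ surrogateGrads h (initSeg g n), ‖x‖ ≤ G := by
  induction n with
  | zero => simp [surrogateGrads_initSeg_zero]
  | succ n ih =>
    intro x hx
    rw [surrogateGrads_initSeg_succ, List.mem_append] at hx
    rcases hx with hx | hx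
    · exact ih x hx
    · split_ifs at hx with hn
      · rw [List.mem_singleton.1 hx]
        exact norm_smul_le_of_abs_le_one (hh _) (hg n)
      · simp at hx

theorem potential_nil (hG : 0 < G) :
    potential G ([] : List (Vec d)).sum (listVariance G ([] : List (Vec d))) = G := by
  simp only [potential, listVariance, List.sum_nil, List.map_nil, norm_zero, add_zero,
    Real.sqrt_sq hG.le]
  simp [pow_two, hG.ne']

theorem sum_inner_featureLearner_le (hG : 0 < G) {ε : ℝ} (hε : 0 ≤ ε) {h : ℕ → ℝ}
    (hh : ∀ i, |h i| ≤ 1) {g : ℕ → Vec d} (hg : ∀ i, ‖g i‖ ≤ G) (n : ℕ) :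
    ∑ i ∈ Finset.range n, inner ℝ (g i) (featureLearner ε G h (initSeg g i))
      ≤ ε * (G - potential G (surrogateGrads h (initSeg g n)).sum
        (listVariance G (surrogateGrads h (initSeg g n)))) := by
  induction n with
  | zero =>
    rw [surrogateGrads_initSeg_zero, potential_nil hG]
    simp
  | succ n ih =>
    rw [Finset.sum_range_succ, surrogateGrads_initSeg_succ]
    unfold featureLearner at ih ⊢
    rw [length_initSeg]
    by_cases hn : h (n + 1) = 0
    · simpa [hn] using ih
    · rw [if_pos hn, inner_smul_right, ← real_inner_smul_left]
      have := inner_freeGrad_le hG hε (surrogateGrads h (initSeg g n))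
        (norm_smul_le_of_abs_le_one (hh (n + 1)) (hg n))
      linarith

/-- Rounds with `h = 0` feed nothing to the copy, so the rate depends on the support size `K` of the
feature rather than on `n`. -/
theorem featureLearner_regret_le (hG : 0 < G) {ε : ℝ} (hε : 0 < ε) {h : ℕ → ℝ}
    (hh : ∀ i, |h i| ≤ 1) {g : ℕ → Vec d} (hg : ∀ i, ‖g i‖ ≤ G) {n K : ℕ}
    (hK : ((Finset.range n).filter fun i => h (i + 1) ≠ 0).card ≤ K) (u : Vec d) {L : ℝ}
    (hL : Real.log (1 + (K + 1) ^ 2 * ‖u‖ / ε) ≤ L) :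
    ∑ i ∈ Finset.range n, inner ℝ (g i) (featureLearner ε G h (initSeg g i) - h (i + 1) • u)
      ≤ ε * G + ‖u‖ * G * √(K + 1) * (2 * L + √(2 * L)) := by
  obtain ⟨S, hS⟩ : ∃ S, S = surrogateGrads h (initSeg g n) := ⟨_, rfl⟩
  have h1 := sum_inner_featureLearner_le hG hε.le hh hg n
  have hlen : (S.length : ℝ) ≤ K := by
    rw [hS, length_surrogateGrads]
    exact_mod_cast hK
  have hmem := norm_le_of_mem_surrogateGrads hh hg n
  rw [← hS] at h1 hmem
  have h2 : ∑ i ∈ Finset.range n, inner ℝ (g i) (h (i + 1) • u) = inner ℝ S.sum u := by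
    rw [hS, sum_surrogateGrads, sum_inner]
    refine Finset.sum_congr rfl fun i _ => ?_
    rw [inner_smul_right, real_inner_smul_left]
  have h3 := mul_sub_potential_le hG hε (norm_nonneg u) (Nat.cast_nonneg K) hL
    (le_listVariance S)
    ((listVariance_le hmem).trans (by gcongr))
    ((norm_list_sum_le hmem).trans (by gcongr))
  have h4 : -(‖S.sum‖ * ‖u‖) ≤ inner ℝ S.sum u :=
    (abs_le.1 (abs_real_inner_le_norm S.sum u)).1
  simp only [inner_sub_right, Finset.sum_sub_distrib]
  rw [h2]
  linarith

/-! ### Haar reconstruction -/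

theorem sum_Icc_one_eq_sum_range {E : Type*} [AddCommMonoid E] (F : ℕ → E) (m : ℕ) :
    ∑ j ∈ Finset.Icc 1 m, F j = ∑ j ∈ Finset.range m, F (j + 1) := by
  induction m with
  | zero => simp
  | succ m ih => rw [Finset.sum_Icc_succ_top (by omega), ih, Finset.sum_range_succ]

theorem sum_range_sum_range_mul_add {E : Type*} [AddCommMonoid E] (f : ℕ → E) (p q : ℕ) :
    ∑ k ∈ Finset.range q, ∑ i ∈ Finset.range p, f (p * k + i) = ∑ i ∈ Finset.range (p * q), f i := by
  induction q with
  | zero => simp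
  | succ q ih => rw [Finset.sum_range_succ, ih, mul_add, mul_one, Finset.sum_range_add]

/-- The mean of a sequence over the dyadic interval `[2 ^ j * k, 2 ^ j * (k + 1))`. -/
def dyadicMean (w : ℕ → Vec d) (j k : ℕ) : Vec d :=
  (2 ^ j : ℝ)⁻¹ • ∑ i ∈ Finset.range (2 ^ j), w (2 ^ j * k + i)

/-- The coefficient of a sequence along the Haar feature of scale `j + 1` and location `k + 1`. -/
def haarCoeff (w : ℕ → Vec d) (j k : ℕ) : Vec d :=
  (2⁻¹ : ℝ) • (dyadicMean w j (2 * k) - dyadicMean w j (2 * k + 1))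

theorem dyadicMean_zero (w : ℕ → Vec d) (k : ℕ) : dyadicMean w 0 k = w k := by
  simp [dyadicMean]

theorem sum_range_two_pow_succ {E : Type*} [AddCommMonoid E] (f : ℕ → E) (j k : ℕ) :
    ∑ i ∈ Finset.range (2 ^ (j + 1)), f (2 ^ (j + 1) * k + i)
      = ∑ i ∈ Finset.range (2 ^ j), f (2 ^ j * (2 * k) + i)
        + ∑ i ∈ Finset.range (2 ^ j), f (2 ^ j * (2 * k + 1) + i) := by
  rw [pow_succ, mul_two, Finset.sum_range_add]
  congr 1 <;> refine Finset.sum_congr rfl fun i _ => ?_ <;> congr 1 <;> ring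

theorem dyadicMean_succ (w : ℕ → Vec d) (j k : ℕ) :
    dyadicMean w (j + 1) k
      = (2⁻¹ : ℝ) • (dyadicMean w j (2 * k) + dyadicMean w j (2 * k + 1)) := by
  unfold dyadicMean
  rw [sum_range_two_pow_succ, ← smul_add, smul_smul, pow_succ, mul_inv, mul_comm]

theorem haarFeature_succ (j k i : ℕ) :
    haarFeature (j + 1) (k + 1) (i + 1)
      = if i / 2 ^ j = 2 * k then 1 else if i / 2 ^ j = 2 * k + 1 then -1 else 0 := by
  have hp : 0 < 2 ^ j := by positivity
  unfold haarFeature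
  simp only [Finset.mem_Icc, Nat.div_eq_iff hp, Nat.add_sub_cancel]
  have e1 : 2 ^ (j + 1) * k = 2 * k * 2 ^ j := by ring
  have e2 : 2 ^ (j + 1) * (k + 1) = 2 * k * 2 ^ j + 2 ^ j + 2 ^ j := by ring
  have e3 : (2 * k + 1) * 2 ^ j = 2 * k * 2 ^ j + 2 ^ j := by ring
  rw [e1, e2, e3]
  generalize 2 * k * 2 ^ j = a
  generalize 2 ^ j = p at *
  congr 1
  · simp only [eq_iff_iff]; omega
  · congr 1
    simp only [eq_iff_iff]; omega

theorem abs_haarFeature_le (j l t : ℕ) : |haarFeature j l t| ≤ 1 := by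
  unfold haarFeature
  split_ifs <;> simp

theorem card_filter_haarFeature_le (j k n : ℕ) :
    ((Finset.range n).filter fun i => haarFeature (j + 1) (k + 1) (i + 1) ≠ 0).card
      ≤ 2 ^ (j + 1) := by
  have hsub : ((Finset.range n).filter fun i => haarFeature (j + 1) (k + 1) (i + 1) ≠ 0)
      ⊆ Finset.Ico (2 ^ (j + 1) * k) (2 ^ (j + 1) * k + 2 ^ (j + 1)) := by
    intro i hi
    have h := (Finset.mem_filter.1 hi).2
    have hp : 0 < 2 ^ j := by positivity
    rw [haarFeature_succ] at h
    have h' : i / 2 ^ j = 2 * k ∨ i / 2 ^ j = 2 * k + 1 := by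
      by_contra! hc
      simp [hc.1, hc.2] at h
    rw [Nat.div_eq_iff hp, Nat.div_eq_iff hp] at h'
    have e1 : 2 ^ (j + 1) * k = 2 * k * 2 ^ j := by ring
    have e2 : 2 ^ (j + 1) = 2 ^ j + 2 ^ j := by ring
    have e3 : (2 * k + 1) * 2 ^ j = 2 * k * 2 ^ j + 2 ^ j := by ring
    rw [Finset.mem_Ico, e1, e2]
    omega
  simpa using Finset.card_le_card hsub

/-- At each scale only the interval containing `i` contributes, and its coefficient is, up to the
sign of the feature, the difference between the half's mean and the whole's. Summed over scales
these differences telescope. -/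
theorem sum_haarFeature_smul (w : ℕ → Vec d) {m j i : ℕ} (hi : i < 2 ^ m) (hj : j < m) :
    ∑ k ∈ Finset.range (2 ^ (m - (j + 1))),
        haarFeature (j + 1) (k + 1) (i + 1) • haarCoeff w j k
      = dyadicMean w j (i / 2 ^ j) - dyadicMean w (j + 1) (i / 2 ^ (j + 1)) := by
  obtain ⟨c, hc⟩ : ∃ c, c = i / 2 ^ j := ⟨_, rfl⟩
  have hc2 : i / 2 ^ (j + 1) = c / 2 := by rw [pow_succ, ← Nat.div_div_eq_div_mul, hc]
  have hlt : c / 2 < 2 ^ (m - (j + 1)) := by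
    rw [← hc2]
    apply Nat.div_lt_of_lt_mul
    rwa [← pow_add, Nat.add_sub_cancel' hj]
  rw [Finset.sum_eq_single_of_mem (c / 2) (Finset.mem_range.2 hlt)]
  · rw [haarFeature_succ, hc2, ← hc, dyadicMean_succ]
    unfold haarCoeff
    rcases Nat.even_or_odd' c with ⟨q, hq | hq⟩
    · rw [show c / 2 = q by omega, if_pos hq, hq]
      module
    · rw [show c / 2 = q by omega, if_neg (by omega), if_pos hq, hq]
      module
  · intro k _ hk
    rw [haarFeature_succ, ← hc, if_neg (by omega), if_neg (by omega), zero_smul]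

theorem haar_reconstruction (w : ℕ → Vec d) {m i : ℕ} (hi : i < 2 ^ m) :
    w i = dyadicMean w m 0 + ∑ j ∈ Finset.range m, ∑ k ∈ Finset.range (2 ^ (m - (j + 1))),
        haarFeature (j + 1) (k + 1) (i + 1) • haarCoeff w j k := by
  rw [Finset.sum_congr rfl fun j hj => sum_haarFeature_smul w hi (Finset.mem_range.1 hj),
    Finset.sum_range_sub' fun j => dyadicMean w j (i / 2 ^ j), Nat.div_eq_of_lt hi, pow_zero,
    Nat.div_one, dyadicMean_zero]
  abel

/-! ### Size of the Haar coefficients -/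

theorem dyadicMean_sub (w : ℕ → Vec d) (z : Vec d) (j k : ℕ) :
    dyadicMean w j k - z
      = (2 ^ j : ℝ)⁻¹ • ∑ i ∈ Finset.range (2 ^ j), (w (2 ^ j * k + i) - z) := by
  unfold dyadicMean
  rw [Finset.sum_sub_distrib, smul_sub, Finset.sum_const, Finset.card_range,
    ← Nat.cast_smul_eq_nsmul ℝ, smul_smul]
  push_cast
  rw [inv_mul_cancel₀ (by positivity), one_smul]

theorem norm_dyadicMean_sub_le {w : ℕ → Vec d} {z : Vec d} {j k : ℕ} {B : ℝ}
    (hB : ∀ i < 2 ^ j, ‖w (2 ^ j * k + i) - z‖ ≤ B) : ‖dyadicMean w j k - z‖ ≤ B := by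
  rw [dyadicMean_sub, norm_smul, norm_inv, norm_pow, Real.norm_two, inv_mul_le_iff₀ (by positivity)]
  have := norm_sum_le_of_le (Finset.range (2 ^ j)) fun i hi => hB i (Finset.mem_range.1 hi)
  simpa using this

theorem norm_dyadicMean_sub_le_sum (w : ℕ → Vec d) (z : Vec d) (j k : ℕ) :
    ‖dyadicMean w j k - z‖
      ≤ (2 ^ j : ℝ)⁻¹ * ∑ i ∈ Finset.range (2 ^ j), ‖w (2 ^ j * k + i) - z‖ := by
  rw [dyadicMean_sub, norm_smul, norm_inv, norm_pow, Real.norm_two]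
  gcongr
  exact norm_sum_le _ _

theorem norm_dyadicMean_le {w : ℕ → Vec d} {M : ℝ} (hM : ∀ i, ‖w i‖ ≤ M) (j k : ℕ) :
    ‖dyadicMean w j k‖ ≤ M := by
  simpa using norm_dyadicMean_sub_le (w := w) (z := 0) (j := j) (k := k) (B := M)
    (by simpa using fun i _ => hM _)

theorem norm_haarCoeff_le {w : ℕ → Vec d} {M : ℝ} (hM : ∀ i, ‖w i‖ ≤ M) (j k : ℕ) :
    ‖haarCoeff w j k‖ ≤ M := by
  unfold haarCoeff
  rw [norm_smul, norm_inv, Real.norm_two]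
  have := norm_sub_le (dyadicMean w j (2 * k)) (dyadicMean w j (2 * k + 1))
  linarith [norm_dyadicMean_le hM j (2 * k), norm_dyadicMean_le hM j (2 * k + 1)]

theorem norm_sub_le_sum_of_le (w : ℕ → Vec d) {a b c e : ℕ} (hab : a ≤ b) (hbc : b ≤ c)
    (hce : c ≤ e) : ‖w c - w b‖ ≤ ∑ i ∈ Finset.Ico a e, ‖w (i + 1) - w i‖ := by
  rw [← Finset.sum_Ico_sub w hbc]
  refine (norm_sum_le _ _).trans ?_
  exact Finset.sum_le_sum_of_subset_of_nonneg (Finset.Ico_subset_Ico hab hce)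
    fun _ _ _ => norm_nonneg _

theorem norm_haarCoeff_le_path (w : ℕ → Vec d) (j k : ℕ) :
    ‖haarCoeff w j k‖ ≤ 2⁻¹ * ∑ i ∈ Finset.range (2 ^ (j + 1)),
      ‖w (2 ^ (j + 1) * k + i + 1) - w (2 ^ (j + 1) * k + i)‖ := by
  unfold haarCoeff
  rw [norm_smul, norm_inv, Real.norm_two]
  gcongr
  refine norm_dyadicMean_sub_le fun i hi => ?_
  rw [norm_sub_rev]
  refine norm_dyadicMean_sub_le fun i' hi' => ?_
  have h := norm_sub_le_sum_of_le w (a := 2 ^ (j + 1) * k) (b := 2 ^ j * (2 * k) + i)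
    (c := 2 ^ j * (2 * k + 1) + i') (e := 2 ^ (j + 1) * k + 2 ^ (j + 1))
    (by rw [pow_succ]; nlinarith) (by rw [mul_add]; omega) (by rw [pow_succ]; nlinarith)
  rwa [Finset.sum_Ico_eq_sum_range, Nat.add_sub_cancel_left] at h

theorem norm_haarCoeff_le_variability (w : ℕ → Vec d) (z : Vec d) (j k : ℕ) :
    ‖haarCoeff w j k‖ ≤ (2 ^ (j + 1) : ℝ)⁻¹ * ∑ i ∈ Finset.range (2 ^ (j + 1)),
      ‖w (2 ^ (j + 1) * k + i) - z‖ := by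
  unfold haarCoeff
  rw [norm_smul, norm_inv, Real.norm_two, sum_range_two_pow_succ fun i => ‖w i - z‖]
  have h0 := norm_sub_le (dyadicMean w j (2 * k) - z) (dyadicMean w j (2 * k + 1) - z)
  rw [sub_sub_sub_cancel_right] at h0
  have h1 := norm_dyadicMean_sub_le_sum w z j (2 * k)
  have h2 := norm_dyadicMean_sub_le_sum w z j (2 * k + 1)
  rw [pow_succ, mul_inv]
  linarith

/-- Multiplying the two bounds gives `2x · Kx ≤ P S`, and `K + 1 ≤ 2K`. -/
theorem mul_sqrt_le_sqrt_mul_sqrt {x K P S : ℝ} (hx : 0 ≤ x) (hK : 1 ≤ K)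
    (h1 : x ≤ 2⁻¹ * P) (h2 : x ≤ K⁻¹ * S) : x * √(K + 1) ≤ √P * √S := by
  have hP : 0 ≤ P := by linarith
  have hK0 : 0 < K := by linarith
  have h3 : K * x ≤ S := by rwa [le_inv_mul_iff₀ hK0] at h2
  rw [← Real.sqrt_mul hP]
  apply Real.le_sqrt_of_sq_le
  rw [mul_pow, Real.sq_sqrt (by linarith)]
  calc x ^ 2 * (K + 1) ≤ x ^ 2 * (2 * K) := by gcongr; linarith
    _ = (2 * x) * (K * x) := by ring
    _ ≤ P * S := by
      gcongr
      linarith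

theorem sum_norm_haarCoeff_le (w : ℕ → Vec d) (z : Vec d) {m j : ℕ} (hj : j < m) :
    ∑ k ∈ Finset.range (2 ^ (m - (j + 1))), ‖haarCoeff w j k‖ * √(2 ^ (j + 1) + 1)
      ≤ √(∑ i ∈ Finset.range (2 ^ m), ‖w (i + 1) - w i‖)
        * √(∑ i ∈ Finset.range (2 ^ m), ‖w i - z‖) := by
  have hm : 2 ^ m = 2 ^ (j + 1) * 2 ^ (m - (j + 1)) := by
    rw [← pow_add, Nat.add_sub_cancel' hj]
  rw [hm, ← sum_range_sum_range_mul_add, ← sum_range_sum_range_mul_add]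
  refine (Finset.sum_le_sum fun k _ => ?_).trans
    (Real.sum_sqrt_mul_sqrt_le _ (fun k => Finset.sum_nonneg fun _ _ => norm_nonneg _)
      fun k => Finset.sum_nonneg fun _ _ => norm_nonneg _)
  exact mul_sqrt_le_sqrt_mul_sqrt (norm_nonneg _) (one_le_pow₀ one_le_two)
    (norm_haarCoeff_le_path w j k) (norm_haarCoeff_le_variability w z j k)

/-! ### Regret of Haar OLR with a known horizon -/

theorem haarFixed_regret_le (hG : 0 < G) {g : ℕ → Vec d} (hg : ∀ i, ‖g i‖ ≤ G) {m n : ℕ}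
    (hn : n ≤ 2 ^ m) {w : ℕ → Vec d} {M L : ℝ} (hM : ∀ i, ‖w i‖ ≤ M)
    (hL : Real.log (1 + (2 ^ m + 1) ^ 2 * M * 2 ^ m) ≤ L) :
    ∑ i ∈ Finset.range n, inner ℝ (g i) (haarFixed m 1 G (initSeg g i) - w i)
      ≤ G + G * (2 * L + √(2 * L)) * (‖dyadicMean w m 0‖ * √(2 ^ m + 1)
        + ∑ j ∈ Finset.range m, ∑ k ∈ Finset.range (2 ^ (m - (j + 1))),
            ‖haarCoeff w j k‖ * √(2 ^ (j + 1) + 1)) := by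
  obtain ⟨ε, hε⟩ : ∃ ε : ℝ, ε = 1 / 2 ^ m := ⟨_, rfl⟩
  have hε0 : 0 < ε := by rw [hε]; positivity
  have hM0 : 0 ≤ M := (norm_nonneg _).trans (hM 0)
  have hlog : ∀ (K : ℕ) (x : Vec d), K ≤ 2 ^ m → ‖x‖ ≤ M →
      Real.log (1 + (K + 1) ^ 2 * ‖x‖ / ε) ≤ L := by
    intro K x hK hx
    refine le_trans (Real.log_le_log (by positivity) ?_) hL
    have hK' : (K : ℝ) ≤ 2 ^ m := by exact_mod_cast hK
    rw [hε, div_div_eq_mul_div, div_one]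
    gcongr
  have h1 := featureLearner_regret_le hG hε0 (h := oneFeature) (by simp [oneFeature]) hg
    (n := n) (K := 2 ^ m) (by simpa [oneFeature] using hn) (dyadicMean w m 0)
    (hlog _ _ le_rfl (norm_dyadicMean_le hM m 0))
  have h2 : ∀ j ∈ Finset.range m, ∀ k,
      ∑ i ∈ Finset.range n, inner ℝ (g i)
        (featureLearner ε G (haarFeature (j + 1) (k + 1)) (initSeg g i)
          - haarFeature (j + 1) (k + 1) (i + 1) • haarCoeff w j k)
      ≤ ε * G + ‖haarCoeff w j k‖ * G * √(2 ^ (j + 1) + 1) * (2 * L + √(2 * L)) := by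
    intro j hj k
    have := featureLearner_regret_le hG hε0 (abs_haarFeature_le (j + 1) (k + 1)) hg
      (card_filter_haarFeature_le j k n) (haarCoeff w j k)
      (hlog _ _ (Nat.pow_le_pow_right two_pos (Finset.mem_range.1 hj)) (norm_haarCoeff_le hM j k))
    exact_mod_cast this
  have hsplit : ∀ i ∈ Finset.range n, inner ℝ (g i) (haarFixed m 1 G (initSeg g i) - w i)
      = inner ℝ (g i) (featureLearner ε G oneFeature (initSeg g i)
          - oneFeature (i + 1) • dyadicMean w m 0)
        + ∑ j ∈ Finset.range m, ∑ k ∈ Finset.range (2 ^ (m - (j + 1))), inner ℝ (g i)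
          (featureLearner ε G (haarFeature (j + 1) (k + 1)) (initSeg g i)
            - haarFeature (j + 1) (k + 1) (i + 1) • haarCoeff w j k) := by
    intro i hi
    have hi' : i < 2 ^ m := (Finset.mem_range.1 hi).trans_le hn
    have hr := haar_reconstruction w hi'
    simp only [← inner_sum]
    rw [← inner_add_right]
    congr 1
    unfold haarFixed
    rw [sum_Icc_one_eq_sum_range, ← hε]
    simp only [sum_Icc_one_eq_sum_range, Finset.sum_sub_distrib]
    nth_rewrite 1 [hr]
    simp only [oneFeature, one_smul]
    abel
  -- There are `1 + (2 ^ m - 1)` features, so their additive costs `G / 2 ^ m` total `G`.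
  have hcount : ε * G + ∑ j ∈ Finset.range m, ∑ _k ∈ Finset.range (2 ^ (m - (j + 1))), ε * G
      = G := by
    have h3 : ∑ j ∈ Finset.range m, (2 : ℝ) ^ (m - (j + 1)) = 2 ^ m - 1 := by
      have := Finset.sum_range_reflect (fun j => (2 : ℝ) ^ j) m
      rw [geom_sum_eq (by norm_num)] at this
      rw [show (2 : ℝ) ^ m - 1 = (2 ^ m - 1) / (2 - 1) by norm_num, ← this]
      refine Finset.sum_congr rfl fun j _ => ?_
      rw [Nat.sub_sub, add_comm 1 j]
    simp only [Finset.sum_const, Finset.card_range, nsmul_eq_mul]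
    push_cast
    rw [← Finset.sum_mul, h3, hε]
    field_simp
    ring
  rw [Finset.sum_congr rfl hsplit, Finset.sum_add_distrib, Finset.sum_comm]
  simp only [fun j => Finset.sum_comm (s := Finset.range n) (t := Finset.range (2 ^ (m - (j + 1))))
    (f := fun i k => inner ℝ (g i)
          (featureLearner ε G (haarFeature (j + 1) (k + 1)) (initSeg g i)
            - haarFeature (j + 1) (k + 1) (i + 1) • haarCoeff w j k))]
  have h4 := Finset.sum_le_sum fun j hj =>
    Finset.sum_le_sum fun k (_ : k ∈ Finset.range (2 ^ (m - (j + 1)))) => h2 j hj k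
  refine (add_le_add h1 h4).trans (le_of_eq ?_)
  simp only [Finset.sum_add_distrib]
  nth_rewrite 5 [← hcount]
  have h5 : ∑ j ∈ Finset.range m, ∑ k ∈ Finset.range (2 ^ (m - (j + 1))),
        ‖haarCoeff w j k‖ * G * √(2 ^ (j + 1) + 1) * (2 * L + √(2 * L))
      = G * (2 * L + √(2 * L)) * ∑ j ∈ Finset.range m, ∑ k ∈ Finset.range (2 ^ (m - (j + 1))),
            ‖haarCoeff w j k‖ * √(2 ^ (j + 1) + 1) := by
    simp only [Finset.mul_sum]
    refine Finset.sum_congr rfl fun j _ => Finset.sum_congr rfl fun k _ => ?_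
    ring
  rw [h5]
  push_cast
  ring

/-- Regret of Haar OLR in terms of a centre `z` of the comparator sequence, a bound `P` for its
path length and a bound `S` for its variability around `z`. -/
theorem haarFixed_regret_le_path (hG : 0 < G) {g : ℕ → Vec d} (hg : ∀ i, ‖g i‖ ≤ G) {m n : ℕ}
    (hn : n ≤ 2 ^ m) {w : ℕ → Vec d} {M L P S : ℝ} {z : Vec d} (hM : ∀ i, ‖w i‖ ≤ M)
    (hL : Real.log (1 + (2 ^ m + 1) ^ 2 * M * 2 ^ m) ≤ L)
    (hP : ∑ i ∈ Finset.range (2 ^ m), ‖w (i + 1) - w i‖ ≤ P)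
    (hP' : ∀ i, ‖w i - z‖ ≤ P)
    (hS : ∑ i ∈ Finset.range (2 ^ m), ‖w i - z‖ ≤ S) :
    ∑ i ∈ Finset.range n, inner ℝ (g i) (haarFixed m 1 G (initSeg g i) - w i)
      ≤ G + G * (2 * L + √(2 * L)) * (‖z‖ * √(2 ^ m + 1) + (m + 2) * √(P * S)) := by
  have hP0 : 0 ≤ P := (norm_nonneg _).trans (hP' 0)
  have hS0 : 0 ≤ S := (Finset.sum_nonneg fun _ _ => norm_nonneg _).trans hS
  have hM0 : 0 ≤ M := (norm_nonneg _).trans (hM 0)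
  have hL0 : 0 ≤ L := (Real.log_nonneg (by
    have : 0 ≤ ((2 : ℝ) ^ m + 1) ^ 2 * M * 2 ^ m := by positivity
    linarith)).trans hL
  refine (haarFixed_regret_le hG hg hn hM hL).trans ?_
  have h1 : ∑ j ∈ Finset.range m, ∑ k ∈ Finset.range (2 ^ (m - (j + 1))),
      ‖haarCoeff w j k‖ * √(2 ^ (j + 1) + 1) ≤ m * √(P * S) := by
    refine (Finset.sum_le_card_nsmul _ _ (√(P * S)) fun j hj => ?_).trans_eq (by simp)
    refine (sum_norm_haarCoeff_le w z (Finset.mem_range.1 hj)).trans ?_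
    rw [Real.sqrt_mul hP0]
    gcongr
  -- The all-one feature competes with the block mean. Its distance to `z` obeys the same two bounds
  -- as a Haar coefficient, with `2P` for the path length.
  have h2 : ‖dyadicMean w m 0 - z‖ * √(2 ^ m + 1) ≤ 2 * √(P * S) := by
    have h3 : ‖dyadicMean w m 0 - z‖ ≤ 2⁻¹ * (2 * P) := by
      rw [inv_mul_cancel_left₀ two_ne_zero]
      exact norm_dyadicMean_sub_le fun i _ => hP' _
    have h4 : ‖dyadicMean w m 0 - z‖ ≤ (2 ^ m : ℝ)⁻¹ * S := by
      refine (norm_dyadicMean_sub_le_sum w z m 0).trans ?_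
      gcongr
      simpa using hS
    refine (mul_sqrt_le_sqrt_mul_sqrt (norm_nonneg _) (one_le_pow₀ one_le_two) h3 h4).trans ?_
    rw [Real.sqrt_mul zero_le_two, Real.sqrt_mul hP0, mul_assoc]
    gcongr
    exact Real.sqrt_le_iff.2 ⟨by norm_num, by norm_num⟩
  have h5 : ‖dyadicMean w m 0‖ ≤ ‖z‖ + ‖dyadicMean w m 0 - z‖ := by
    have := norm_add_le z (dyadicMean w m 0 - z)
    rwa [add_sub_cancel] at this
  have h6 := mul_le_mul_of_nonneg_right h5 (Real.sqrt_nonneg (2 ^ m + 1))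
  exact add_le_add le_rfl (mul_le_mul_of_nonneg_left (by linarith) (by positivity))

/-! ### The comparator sequence, extended by its average -/

/-- The comparator sequence, numbered from `0` and continued by its average. -/
def extendByAverage {T : ℕ} (u : Fin T → Vec d) (i : ℕ) : Vec d :=
  if h : i < T then u ⟨i, h⟩ else average u

theorem extendByAverage_of_le {T : ℕ} (u : Fin T → Vec d) {i : ℕ} (hi : T ≤ i) :
    extendByAverage u i = average u := dif_neg (by omega)

theorem extendByAverage_fin {T : ℕ} (u : Fin T → Vec d) (t : Fin T) :
    extendByAverage u t = u t := dif_pos t.2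

theorem norm_average_sub_le {T : ℕ} (hT : 1 ≤ T) (u : Fin T → Vec d) {x : Vec d} {B : ℝ}
    (hB : ∀ t, ‖u t - x‖ ≤ B) : ‖average u - x‖ ≤ B := by
  have hT0 : (0 : ℝ) < T := by exact_mod_cast hT
  have e : average u - x = (T : ℝ)⁻¹ • ∑ t, (u t - x) := by
    unfold average
    rw [Finset.sum_sub_distrib, smul_sub, Finset.sum_const, Finset.card_univ, Fintype.card_fin,
      ← Nat.cast_smul_eq_nsmul ℝ, smul_smul, inv_mul_cancel₀ hT0.ne', one_smul]
  rw [e, norm_smul, norm_inv, Real.norm_of_nonneg hT0.le, inv_mul_le_iff₀ hT0]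
  simpa using norm_sum_le_of_le Finset.univ fun t _ => hB t

theorem norm_le_maxRange {T : ℕ} (u : Fin T → Vec d) (t : Fin T) : ‖u t‖ ≤ maxRange u :=
  le_ciSup (f := fun t => ‖u t‖) (Set.finite_range _).bddAbove t

theorem norm_extendByAverage_le {T : ℕ} (hT : 1 ≤ T) (u : Fin T → Vec d) (i : ℕ) :
    ‖extendByAverage u i‖ ≤ maxRange u := by
  unfold extendByAverage
  split_ifs with h
  · exact norm_le_maxRange u _
  · simpa using norm_average_sub_le hT u (x := 0) fun t => by simpa using norm_le_maxRange u t

theorem pathLength_eq_sum_range {T : ℕ} (u : Fin T → Vec d) :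
    pathLength u
      = ∑ i ∈ Finset.range (T - 1), ‖extendByAverage u (i + 1) - extendByAverage u i‖ := by
  rw [Finset.sum_range]
  refine Finset.sum_congr rfl fun t _ => ?_
  have h1 : (t : ℕ) + 1 < T := by omega
  have h2 : (t : ℕ) < T := by omega
  simp [extendByAverage, h1, h2]

theorem norm_extendByAverage_sub_le_of_le {T : ℕ} (u : Fin T → Vec d) {a b : ℕ} (hab : a ≤ b)
    (hb : b < T) : ‖extendByAverage u b - extendByAverage u a‖ ≤ pathLength u := by
  rw [pathLength_eq_sum_range, Finset.range_eq_Ico]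
  exact norm_sub_le_sum_of_le _ (Nat.zero_le a) hab (by omega)

theorem pathLength_nonneg {T : ℕ} (u : Fin T → Vec d) : 0 ≤ pathLength u :=
  Finset.sum_nonneg fun _ _ => norm_nonneg _

theorem norm_extendByAverage_sub_average_le {T : ℕ} (u : Fin T → Vec d)
    (i : ℕ) : ‖extendByAverage u i - average u‖ ≤ pathLength u := by
  rcases lt_or_ge i T with h | h
  · rw [norm_sub_rev]
    refine norm_average_sub_le (by omega) u fun t => ?_
    rw [← extendByAverage_fin u]
    rcases le_total i t with hit | hit
    · exact norm_extendByAverage_sub_le_of_le u hit t.2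
    · rw [norm_sub_rev]
      exact norm_extendByAverage_sub_le_of_le u hit h
  · rw [extendByAverage_of_le u h, sub_self, norm_zero]
    exact pathLength_nonneg u

theorem sum_range_shift_le {f : ℕ → ℝ} (hf : ∀ i, 0 ≤ f i) {T : ℕ} (hT : ∀ i, T ≤ i → f i = 0)
    (a n : ℕ) : ∑ i ∈ Finset.range n, f (a + i) ≤ ∑ i ∈ Finset.range T, f i := by
  calc ∑ i ∈ Finset.range n, f (a + i)
      ≤ ∑ i ∈ Finset.range a, f i + ∑ i ∈ Finset.range n, f (a + i) :=
        le_add_of_nonneg_left (Finset.sum_nonneg fun i _ => hf i)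
    _ = ∑ i ∈ Finset.range (a + n), f i := (Finset.sum_range_add f a n).symm
    _ ≤ ∑ i ∈ Finset.range (T + (a + n)), f i :=
        Finset.sum_le_sum_of_subset_of_nonneg (Finset.range_mono (by omega)) fun i _ _ => hf i
    _ = ∑ i ∈ Finset.range T, f i := by
        rw [Finset.sum_range_add, Finset.sum_eq_zero (s := Finset.range (a + n)), add_zero]
        exact fun i _ => hT _ (by omega)

theorem sum_norm_extendByAverage_sub_average_le {T : ℕ} (u : Fin T → Vec d) (a n : ℕ) :
    ∑ i ∈ Finset.range n, ‖extendByAverage u (a + i) - average u‖ ≤ variability u := by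
  refine (sum_range_shift_le (f := fun i => ‖extendByAverage u i - average u‖) (T := T)
    (fun _ => norm_nonneg _) (fun i hi => by simp [extendByAverage_of_le u hi]) a n).trans_eq ?_
  rw [Finset.sum_range]
  exact Finset.sum_congr rfl fun t _ => by rw [extendByAverage_fin]

/-- Continuing by the average fills up the last, possibly incomplete block. The only new increment
is the jump from the last comparator to the average, itself at most the path length. -/
theorem sum_norm_extendByAverage_succ_sub_le {T : ℕ} (hT : 1 ≤ T) (u : Fin T → Vec d) (a n : ℕ) :
    ∑ i ∈ Finset.range n, ‖extendByAverage u (a + (i + 1)) - extendByAverage u (a + i)‖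
      ≤ 2 * pathLength u := by
  refine (sum_range_shift_le (f := fun i => ‖extendByAverage u (i + 1) - extendByAverage u i‖)
    (T := T) (fun _ => norm_nonneg _) (fun i hi => by
      rw [extendByAverage_of_le u hi, extendByAverage_of_le u (by omega), sub_self, norm_zero])
    a n).trans ?_
  obtain ⟨T, rfl⟩ : ∃ k, T = k + 1 := ⟨T - 1, by omega⟩
  rw [Finset.sum_range_succ, extendByAverage_of_le u le_rfl, norm_sub_rev (average u), two_mul]
  exact add_le_add (pathLength_eq_sum_range u).ge (norm_extendByAverage_sub_average_le u T)

/-! ### Regret of the anytime algorithm -/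

theorem log_horizon_le {N M X : ℝ} (hN : 0 ≤ N) (hM : 0 ≤ M) (hX1 : 1 ≤ X) (hNX : N + 1 ≤ X)
    (hMX : M + 1 ≤ X) :
    Real.log (1 + (N + 1) ^ 2 * M * N) ≤ 4 * Real.log X := by
  rw [show 4 * Real.log X = Real.log (X ^ 4) by rw [Real.log_pow]; norm_num]
  apply Real.log_le_log (by positivity)
  have hX3 : 1 ≤ X ^ 3 := one_le_pow₀ hX1
  calc 1 + (N + 1) ^ 2 * M * N ≤ X ^ 3 + X ^ 2 * M * X := by
        gcongr
        linarith
    _ = X ^ 3 * (M + 1) := by ring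
    _ ≤ X ^ 3 * X := by gcongr
    _ = X ^ 4 := by ring

theorem natLog_two_le {n : ℕ} (hn : n ≠ 0) : (Nat.log 2 n : ℝ) ≤ 2 * Real.log n := by
  have h : (2 : ℝ) ^ Nat.log 2 n ≤ n := by exact_mod_cast Nat.pow_log_le_self 2 hn
  have h2 := Real.log_le_log (by positivity) h
  rw [Real.log_pow] at h2
  have h3 := Real.log_two_gt_d9
  have : (0 : ℝ) ≤ Nat.log 2 n := Nat.cast_nonneg _
  nlinarith

theorem anytimeHaar_initSeg (g : ℕ → Vec d) {m i : ℕ} (hm : 1 ≤ m) (hi : i < 2 ^ m) :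
    anytimeHaar G (initSeg g (2 ^ m - 2 + i))
      = haarFixed m 1 G (initSeg (fun i => g (2 ^ m - 2 + i)) i) := by
  have h2 : 2 ≤ 2 ^ m := by simpa using Nat.pow_le_pow_right two_pos hm
  have hlog : Nat.log 2 (2 ^ m - 2 + i + 2) = m := by
    rw [show 2 ^ m - 2 + i + 2 = 2 ^ m + i by omega]
    exact (Nat.log_eq_iff (by omega)).2 ⟨by omega, by rw [pow_succ]; omega⟩
  unfold anytimeHaar
  simp only [length_initSeg, hlog, initSeg_drop]

theorem anytimeHaar_block_le (hG : 0 < G) {g : ℕ → Vec d} (hg : ∀ i, ‖g i‖ ≤ G) {T : ℕ}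
    (hT : 1 ≤ T) (u : Fin T → Vec d) {m n : ℕ} (hm : 1 ≤ m) (hmT : 2 ^ m ≤ T + 1)
    (hn : n ≤ 2 ^ m) :
    ∑ i ∈ Finset.range n, inner ℝ (g (2 ^ m - 2 + i))
        (anytimeHaar G (initSeg g (2 ^ m - 2 + i)) - extendByAverage u (2 ^ m - 2 + i))
      ≤ G + 128 * G * (‖average u‖ * √T + √(pathLength u * variability u))
        * Real.log (2 + maxRange u + T) ^ 2 := by
  have hM0 : 0 ≤ maxRange u := (norm_nonneg _).trans (norm_extendByAverage_le hT u 0)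
  have hT1 : (1 : ℝ) ≤ T := by exact_mod_cast hT
  have hmT' : (2 : ℝ) ^ m ≤ T + 1 := by exact_mod_cast hmT
  obtain ⟨X, hX⟩ : ∃ X, X = 2 + maxRange u + T := ⟨_, rfl⟩
  obtain ⟨ℓ, hℓ⟩ : ∃ ℓ, ℓ = Real.log X := ⟨_, rfl⟩
  -- Here `X ≥ 3 > e`; this lets constants and square roots be absorbed into powers of `ℓ`.
  have hℓ1 : 1 ≤ ℓ := by
    rw [hℓ, Real.le_log_iff_exp_le (by linarith)]
    have := Real.exp_one_lt_d9
    linarith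
  have hL : Real.log (1 + (2 ^ m + 1) ^ 2 * maxRange u * 2 ^ m) ≤ 4 * ℓ := by
    rw [hℓ]
    exact log_horizon_le (by positivity) hM0 (by linarith) (by linarith) (by linarith)
  have hmℓ : (m : ℝ) ≤ 2 * ℓ := by
    have h1 : m ≤ Nat.log 2 (T + 1) := Nat.le_log_of_pow_le (by norm_num) hmT
    have h2 := natLog_two_le (n := T + 1) (by omega)
    have h3 : Real.log ((T + 1 : ℕ) : ℝ) ≤ ℓ := by
      rw [hℓ]
      push_cast
      exact Real.log_le_log (by positivity) (by linarith)
    have h4 : (m : ℝ) ≤ Nat.log 2 (T + 1) := by exact_mod_cast h1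
    linarith
  have main := haarFixed_regret_le_path hG (g := fun i => g (2 ^ m - 2 + i)) (fun i => hg _) hn
    (w := fun i => extendByAverage u (2 ^ m - 2 + i)) (z := average u)
    (fun i => norm_extendByAverage_le hT u _) hL
    (sum_norm_extendByAverage_succ_sub_le hT u (2 ^ m - 2) (2 ^ m))
    (fun i => (norm_extendByAverage_sub_average_le u _).trans
      (by linarith [pathLength_nonneg u]))
    (sum_norm_extendByAverage_sub_average_le u (2 ^ m - 2) (2 ^ m))
  rw [Finset.sum_congr rfl fun i hi => by
    rw [anytimeHaar_initSeg g hm ((Finset.mem_range.1 hi).trans_le hn)]]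
  refine main.trans ?_
  rw [← hX, ← hℓ]
  have hΛ : 2 * (4 * ℓ) + √(2 * (4 * ℓ)) ≤ 16 * ℓ := by
    have : √(2 * (4 * ℓ)) ≤ 8 * ℓ := Real.sqrt_le_iff.2 ⟨by linarith, by nlinarith⟩
    linarith
  have hsT : √((2 : ℝ) ^ m + 1) ≤ 2 * √T := by
    refine Real.sqrt_le_iff.2 ⟨by positivity, ?_⟩
    rw [mul_pow, Real.sq_sqrt (by positivity)]
    linarith
  have hPS : √(2 * pathLength u * variability u) ≤ 2 * √(pathLength u * variability u) := by
    rw [mul_assoc, Real.sqrt_mul zero_le_two]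
    gcongr
    exact Real.sqrt_le_iff.2 ⟨by norm_num, by norm_num⟩
  calc G + G * (2 * (4 * ℓ) + √(2 * (4 * ℓ))) * (‖average u‖ * √(2 ^ m + 1)
        + (m + 2) * √(2 * pathLength u * variability u))
      ≤ G + G * (16 * ℓ) * (‖average u‖ * (2 * √T)
        + (2 * ℓ + 2 * ℓ) * (2 * √(pathLength u * variability u))) := by
        gcongr
        linarith
    _ ≤ G + G * (16 * ℓ) * (8 * ℓ * (‖average u‖ * √T)
        + 8 * ℓ * √(pathLength u * variability u)) := by
        gcongr G + G * (16 * ℓ) * ?_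
        have : 0 ≤ ‖average u‖ * √T := by positivity
        nlinarith
    _ = _ := by ring

theorem anytimeHaar_linear_regret_le (hG : 0 < G) {g : ℕ → Vec d} (hg : ∀ i, ‖g i‖ ≤ G) {T : ℕ}
    (hT : 1 ≤ T) (u : Fin T → Vec d) :
    ∑ i ∈ Finset.range T, inner ℝ (g i) (anytimeHaar G (initSeg g i) - extendByAverage u i)
      ≤ Nat.log 2 (T + 1) * (G + 128 * G * (‖average u‖ * √T + √(pathLength u * variability u))
        * Real.log (2 + maxRange u + T) ^ 2) := by
  obtain ⟨B, hB⟩ : ∃ B, B = G + 128 * G * (‖average u‖ * √T + √(pathLength u * variability u))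
    * Real.log (2 + maxRange u + T) ^ 2 := ⟨_, rfl⟩
  have hB0 : 0 ≤ B := by rw [hB]; positivity
  rw [← hB]
  -- The first `b` blocks comprise `2 ^ (b + 1) - 2` rounds; `n` may stop inside the last one.
  have key : ∀ b n : ℕ, n ≤ T → n ≤ 2 ^ (b + 1) - 2 →
      ∑ i ∈ Finset.range n, inner ℝ (g i) (anytimeHaar G (initSeg g i) - extendByAverage u i)
        ≤ b * B := by
    intro b
    induction b with
    | zero =>
      intro n _ hn
      obtain rfl : n = 0 := by simpa using hn
      simp
    | succ b ih =>
      intro n hnT hn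
      push_cast
      rcases le_or_gt n (2 ^ (b + 1) - 2) with h | h
      · linarith [ih n hnT h]
      · obtain ⟨c, rfl⟩ := Nat.exists_eq_add_of_lt h
        have h2 : 2 ≤ 2 ^ (b + 1) := by
          simpa using Nat.pow_le_pow_right two_pos (Nat.le_add_left 1 b)
        rw [pow_succ 2 (b + 1)] at hn
        rw [add_assoc, Finset.sum_range_add]
        have h3 := ih (2 ^ (b + 1) - 2) (by omega) le_rfl
        have h4 := anytimeHaar_block_le hG hg hT u (m := b + 1) (n := c + 1) (by omega)
          (by omega) (by omega)
        rw [← hB] at h4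
        linarith
  refine key _ T le_rfl ?_
  have := Nat.lt_pow_succ_log_self one_lt_two (T + 1)
  omega

/-! ### From linear to convex losses -/

/-- Testing the subgradient inequality at `x + g` gives `‖g‖² ≤ G ‖g‖`. -/
theorem norm_grad_le (hG : 0 < G) (env : Environment d G) (past : List (Vec d)) (x : Vec d) :
    ‖env.grad past x‖ ≤ G := by
  obtain ⟨g, hg⟩ : ∃ g, g = env.grad past x := ⟨_, rfl⟩
  have h1 := env.subgradient past x (x + g)
  have h2 := (env.lipschitz past x).dist_le_mul (x + g) x
  rw [← hg, add_sub_cancel_left, real_inner_self_eq_norm_sq] at h1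
  rw [Real.dist_eq, dist_eq_norm, add_sub_cancel_left, Real.coe_toNNReal G hG.le] at h2
  rw [← hg]
  have h3 := le_of_abs_le h2
  by_contra! hc
  nlinarith [norm_nonneg g]

theorem play_snd_eq_initSeg (A : Learner d) (env : Environment d G) (t : ℕ) :
    (play A env t).2 = initSeg (fun i => env.grad (play A env i).1 (prediction A env i)) t := by
  induction t with
  | zero => simp [play, initSeg]
  | succ t ih => rw [initSeg_succ, ← ih]; rfl

theorem regret_le_of_linear_regret_le (hG : 0 < G) (A : Learner d) {T : ℕ} (u : Fin T → Vec d)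
    {R : ℝ} (hR : ∀ g : ℕ → Vec d, (∀ i, ‖g i‖ ≤ G) →
      ∑ i ∈ Finset.range T, inner ℝ (g i) (A (initSeg g i) - extendByAverage u i) ≤ R) :
    regret A G u ≤ (R : EReal) := by
  refine iSup_le fun env => EReal.coe_le_coe_iff.2 ?_
  refine le_trans ?_ (hR (fun i => env.grad (play A env i).1 (prediction A env i))
    fun i => norm_grad_le hG env _ _)
  rw [← Finset.sum_sub_distrib, Finset.sum_range]
  refine Finset.sum_le_sum fun t _ => ?_
  rw [← play_snd_eq_initSeg, extendByAverage_fin]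
  have h := env.subgradient (play A env t).1 (prediction A env t) (u t)
  rw [← neg_sub, inner_neg_right] at h
  change env.loss _ _ _ - env.loss _ _ _ ≤ inner ℝ _ (prediction A env t - u t)
  linarith

end HaarOLR

end

theorem theorem3 :
    ∃ (C : ℝ) (k : ℕ), 0 < C ∧
      ∀ (d : ℕ) (G : ℝ), 0 < G → ∀ (T : ℕ), 1 ≤ T → ∀ (u : Fin T → HaarOLR.Vec d),
        HaarOLR.regret (HaarOLR.anytimeHaar G) G u ≤
          ((C * G * Real.log (T + 1)
            + C * G * (‖HaarOLR.average u‖ * √(T : ℝ)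
                + √(HaarOLR.pathLength u * HaarOLR.variability u))
              * Real.log (2 + HaarOLR.maxRange u + T) ^ k : ℝ) : EReal) := by
  -- At most `2 log (T + 1)` blocks, each costing `G + 128 G (…) ℓ²`: hence `256 = 2 · 128` and a
  -- third logarithm.
  refine ⟨256, 3, by norm_num, fun d G hG T hT u => ?_⟩
  refine HaarOLR.regret_le_of_linear_regret_le hG _ u fun g hg =>
    (HaarOLR.anytimeHaar_linear_regret_le hG hg hT u).trans ?_
  have hb := HaarOLR.natLog_two_le (n := T + 1) (by omega)
  push_cast at hb
  have hM0 : 0 ≤ HaarOLR.maxRange u :=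
    (norm_nonneg _).trans (HaarOLR.norm_extendByAverage_le hT u 0)
  have hl : Real.log (T + 1) ≤ Real.log (2 + HaarOLR.maxRange u + T) :=
    Real.log_le_log (by positivity) (by linarith)
  have hl0 : 0 ≤ Real.log ((T : ℝ) + 1) :=
    Real.log_nonneg (by linarith [Nat.cast_nonneg (α := ℝ) T])
  set ℓ := Real.log (2 + HaarOLR.maxRange u + T)
  set Q := ‖HaarOLR.average u‖ * √(T : ℝ) + √(HaarOLR.pathLength u * HaarOLR.variability u)
  have hQ : 0 ≤ 128 * G * Q * ℓ ^ 2 := by positivity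
  have h1 := mul_le_mul_of_nonneg_right hb hG.le
  have h2 := mul_le_mul_of_nonneg_right (hb.trans (mul_le_mul_of_nonneg_left hl zero_le_two)) hQ
  have h3 : 0 ≤ G * Real.log (T + 1) := mul_nonneg hG.le hl0
  linarith
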